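/- Let $P$ be a connected diagram of a link $L$ in $S^3$. Let $\mathbb{D}(A)$ (resp. $\mathbb{D}(B)$) be the oriented ribbon graph of the all-$A$ (resp. all-$B$) Kauffman state of $P$. Its vertices are the circles obtained by $A$-splicing (resp. $B$-splicing) all crossings, oriented anticlockwise or clockwise according to whether they lie inside an even or an odd number of the other circles. Its edges are the splicing arcs, one for each crossing. The cyclic order of the half-edges at a vertex is the order in which the oriented circle meets the ends of the splicing arcs. The genus $g(\mathbb{D})$ of a ribbon graph with $v$ vertices, $e$ edges, $f$ faces and $k$ components is defined by $v-e+f=2k-2g(\mathbb{D})$. The diagram $P$ is called adequate if neither $\mathbb{D}(A)$ nor $\mathbb{D}(B)$ has a loop. If $P$ is a connected adequate diagram of $L$, then $g(\mathbb{D}(A))=g(\mathbb{D}(B))$, and this number is an invariant of the link $L$: it is the same for all connected adequate diagrams of $L$. -/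

import Mathlib

/-! ### Oriented ribbon graphs -/

/-- The number of cycles (orbits) of a permutation, fixed points included. -/
noncomputable def numCycles {β : Type} (σ : Equiv.Perm β) : ℕ :=
  Nat.card (Quotient (Equiv.Perm.SameCycle.setoid σ))

/-- An oriented ribbon graph: three permutations of a finite set `B` of half-edges such that `σ₁` is
a fixed point free involution and `σ₀ σ₁ σ₂ = 1`.  Every such triple is the disjoint union of its
restrictions to the orbits of `⟨σ₀, σ₁⟩`, which are connected ribbon graphs with half-edges.
A connected ribbon graph without half-edges has one vertex and one face; `isolated` is the number
of components of this kind. -/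
structure RibbonGraph where
  B : Type
  finB : Finite B
  σ₀ : Equiv.Perm B
  σ₁ : Equiv.Perm B
  σ₂ : Equiv.Perm B
  σ₁_invol : ∀ b, σ₁ (σ₁ b) = b
  σ₁_ne : ∀ b, σ₁ b ≠ b
  σ_mul : ∀ b, σ₀ (σ₁ (σ₂ b)) = b
  isolated : ℕ

namespace RibbonGraph

/-- The number of vertices. -/
noncomputable def v (R : RibbonGraph) : ℕ := numCycles R.σ₀ + R.isolated

/-- The number of edges. -/
noncomputable def e (R : RibbonGraph) : ℕ := numCycles R.σ₁

/-- The number of faces. -/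
noncomputable def f (R : RibbonGraph) : ℕ := numCycles R.σ₂ + R.isolated

/-- The number of connected components. -/
noncomputable def k (R : RibbonGraph) : ℕ :=
  Nat.card (MulAction.orbitRel.Quotient (Subgroup.closure {R.σ₀, R.σ₁}) R.B) + R.isolated

/-- The genus, the solution `g` of `v - e + f = 2 k - 2 g`. -/
noncomputable def genus (R : RibbonGraph) : ℚ :=
  (2 * (R.k : ℚ) - R.v + R.e - R.f) / 2

/-- The edge with half-edges `b` and `σ₁ b` is a loop if both lie at the same vertex. -/
def Loopless (R : RibbonGraph) : Prop := ∀ b, ¬ R.σ₀.SameCycle b (R.σ₁ b)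

end RibbonGraph

/-! ### Link diagrams -/

/-- A link diagram on a closed oriented surface, as a planar diagram code.  At each crossing `x` the
four ends `(x, 0), (x, 1), (x, 2), (x, 3)` are listed counterclockwise; `(x, 0)` and `(x, 2)` are
the ends of the lower strand, `(x, 1)` and `(x, 3)` the ends of the upper strand.  Elements of `E`
are the arcs of the diagram between consecutive crossings (overcrossings and undercrossings alike)
and `label` tells which arc leaves at an end.  An arc has two ends, or none at all: then it is a
closed curve without crossings. -/
structure DiagramCode where
  X : Type
  E : Type
  finX : Finite X
  finE : Finite E
  label : X × ZMod 4 → E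
  label_fiber : ∀ a, {h | label h = a}.ncard = 2 ∨ {h | label h = a} = ∅

namespace DiagramCode

variable (D : DiagramCode)

theorem existsUnique_otherEnd (h : D.X × ZMod 4) :
    ∃! h', h' ≠ h ∧ D.label h' = D.label h := by
  rcases D.label_fiber (D.label h) with h2 | h0
  · obtain ⟨u, w, huw, hs⟩ := Set.ncard_eq_two.mp h2
    have key : ∀ t, D.label t = D.label h ↔ t = u ∨ t = w := fun t => by
      have := Set.ext_iff.mp hs t
      simpa using this
    rcases (key h).mp rfl with rfl | rfl
    · refine ⟨w, ⟨huw.symm, (key w).mpr (Or.inr rfl)⟩, ?_⟩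
      rintro t ⟨ht, ht'⟩
      exact ((key t).mp ht').resolve_left ht
    · refine ⟨u, ⟨huw, (key u).mpr (Or.inl rfl)⟩, ?_⟩
      rintro t ⟨ht, ht'⟩
      exact ((key t).mp ht').resolve_right ht
  · exact absurd (show h ∈ {h' | D.label h' = D.label h} from rfl) (by rw [h0]; simp)

/-- The other end of the arc that leaves at the end `h`. -/
noncomputable def otherEnd (h : D.X × ZMod 4) : D.X × ZMod 4 :=
  (D.existsUnique_otherEnd h).choose

theorem otherEnd_ne (h : D.X × ZMod 4) : D.otherEnd h ≠ h :=
  (D.existsUnique_otherEnd h).choose_spec.1.1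

theorem label_otherEnd (h : D.X × ZMod 4) : D.label (D.otherEnd h) = D.label h :=
  (D.existsUnique_otherEnd h).choose_spec.1.2

theorem otherEnd_involutive : Function.Involutive D.otherEnd := fun h =>
  (D.existsUnique_otherEnd (D.otherEnd h)).unique
    ⟨D.otherEnd_ne _, D.label_otherEnd _⟩ ⟨(D.otherEnd_ne h).symm, (D.label_otherEnd h).symm⟩

/-- `otherEnd` as a permutation; its cycles are the arcs that have ends. -/
noncomputable def arcPerm : Equiv.Perm (D.X × ZMod 4) := D.otherEnd_involutive.toPerm

/-- The permutation whose cycles are the faces of the diagram.  Here `(x, i)` stands for the corner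
between the ends `(x, i)` and `(x, i + 1)`; leaving `x` at the end `(x, i)` with this corner on the
left and arriving at the end `(y, j)`, the next corner on the left is `(y, j - 1)`. -/
noncomputable def facePerm : Equiv.Perm (D.X × ZMod 4) :=
  D.arcPerm.trans ((Equiv.refl D.X).prodCongr (Equiv.subRight 1))

/-- Two crossings are adjacent if some arc joins them. -/
def Adj (x y : D.X) : Prop := ∃ i j, D.label (x, i) = D.label (y, j)

/-- All connected components are drawn on spheres: the Euler characteristic `V - E + F` of the
4-valent graph formed by the crossings and the arcs with ends is twice its number of components.
(Closed curves without crossings do not matter.) -/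
def IsPlanar : Prop :=
  (Nat.card D.X : ℤ) - numCycles D.arcPerm + numCycles D.facePerm = 2 * Nat.card (Quot D.Adj)

/-- The arcs `a` and `b` have ends at a common crossing. -/
def Touch (a b : D.E) : Prop := ∃ x i j, D.label (x, i) = a ∧ D.label (x, j) = b

/-- The underlying plane curve is non-empty and connected. -/
def IsConnected : Prop := Nonempty D.E ∧ ∀ a b, Relation.EqvGen D.Touch a b

/-- The end of the same strand on the other side of the crossing. -/
def opp {X : Type} (h : X × ZMod 4) : X × ZMod 4 := (h.1, h.2 + 2)

/-- The positions `i` and `j` belong both to upper strands or both to lower strands. -/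
def SameLevel (i j : ZMod 4) : Prop := i = j ∨ i = j + 2

end DiagramCode

/-- A link diagram in the plane (or, equivalently, on the sphere).  The mutual position of
different connected components is not recorded: it does not affect the link. -/
structure LinkDiagram extends DiagramCode where
  planar : toDiagramCode.IsPlanar

open DiagramCode

/-! ### Reidemeister moves and links -/

namespace LinkDiagram

/-- The diagrams agree up to the names of crossings and arcs, and up to listing the ends of a
crossing from the one or the other end of its lower strand. -/
def Iso (D D' : LinkDiagram) : Prop :=
  ∃ (p : D.X ≃ D'.X) (q : D.E ≃ D'.E) (r : D.X → ZMod 4), (∀ x, r x = 0 ∨ r x = 2) ∧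
    ∀ x i, D'.label (p x, i + r x) = q (D.label (x, i))

/-- `D'` results from `D` by removing the crossings in `S` and letting every strand pass through
the places where they were: arcs that are opposite at a crossing in `S` become parts of one arc. -/
def Erase (D : LinkDiagram) (S : Set D.X) (D' : LinkDiagram) : Prop :=
  ∃ (p : D'.X ≃ {x : D.X // x ∉ S}) (q : D.E → D'.E),
    Function.Surjective q ∧
    (∀ a b, q a = q b ↔
      Relation.EqvGen (fun u w => ∃ x ∈ S, ∃ i, D.label (x, i) = u ∧ D.label (x, i + 2) = w) a b) ∧
    ∀ x i, D'.label (x, i) = q (D.label ((p x).1, i))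

/-- First Reidemeister move: `D'` results from `D` by removing a kink, i.e. a crossing at which an
arc returns at the neighbouring position (and so bounds a face with one corner). -/
def MoveI (D D' : LinkDiagram) : Prop :=
  ∃ x i, D.label (x, i) = D.label (x, i + 1) ∧ D.Erase {x} D'

/-- Second Reidemeister move: `D'` results from `D` by pulling apart two strands that bound a face
with two corners, one strand being above the other at both corners. -/
def MoveII (D D' : LinkDiagram) : Prop :=
  ∃ (x y : D.X) (i j : ZMod 4), x ≠ y ∧ SameLevel i j ∧
    D.label (x, i) = D.label (y, j) ∧ D.label (x, i + 1) = D.label (y, j - 1) ∧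
    D.Erase {x, y} D'

/-- The effect of the third move on the strand that contains the side of the triangle with ends
`h` and `k`: the strand `opp h → h → k → opp k` passes through the crossings of `h` and `k` in the
other order afterwards.  `l` and `l'` are the labels before and after the move. -/
def Slide {X E : Type} (l l' : X × ZMod 4 → E) (h k : X × ZMod 4) : Prop :=
  l' (opp h) = l h ∧ l' h = l (opp k) ∧ l' (opp k) = l k ∧ l' k = l (opp h)

/-- Third Reidemeister move: in `D` the corners `(x, i)`, `(y, j)`, `(z, k)` are those of a
triangular face, one of whose sides lies above both others, at its two ends (equivalently, it is
not the case that each side lies above at one end and below at the other), and `D'` results by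
moving each of the three strands across the crossing of the other two. -/
def MoveIII (D D' : LinkDiagram) : Prop :=
  ∃ (p : D.X ≃ D'.X) (q : D.E ≃ D'.E) (x y z : D.X) (i j k : ZMod 4),
    x ≠ y ∧ y ≠ z ∧ z ≠ x ∧
    D.label (x, i) = D.label (y, j + 1) ∧
    D.label (y, j) = D.label (z, k + 1) ∧
    D.label (z, k) = D.label (x, i + 1) ∧
    ¬ (SameLevel i j ∧ SameLevel j k) ∧
    (let l : D.X × ZMod 4 → D'.E := fun h => q (D.label h)
     let l' : D.X × ZMod 4 → D'.E := fun h => D'.label (p h.1, h.2)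
     Slide l l' (x, i) (y, j + 1) ∧ Slide l l' (y, j) (z, k + 1) ∧ Slide l l' (z, k) (x, i + 1) ∧
     ∀ w m, w ≠ x → w ≠ y → w ≠ z → l' (w, m) = l (w, m))

/-- The diagrams differ by one Reidemeister move or by an isomorphism. -/
def Step (D D' : LinkDiagram) : Prop :=
  D.Iso D' ∨ D.MoveI D' ∨ D.MoveII D' ∨ D.MoveIII D'

end LinkDiagram

/-- A link: a class of link diagrams under the equivalence relation generated by the Reidemeister
moves (and isomorphism of diagrams). -/
def Link : Type 1 := Quot LinkDiagram.Step

/-- The link presented by a diagram. -/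
def LinkDiagram.link (D : LinkDiagram) : Link := Quot.mk _ D

/-! ### The ribbon graph of a Kauffman state -/

/-- The two ways of splicing a crossing. -/
inductive Splice
  | A
  | B

/-- The end that is joined with the end `i` by a splice.  The `A`-splice joins `0` with `1` and `2`
with `3` (it opens the two corners that the upper strand sweeps when turned counterclockwise);
the `B`-splice joins `1` with `2` and `3` with `0`. -/
def Splice.partner : Splice → ZMod 4 → ZMod 4
  | .A, i => if i = 0 ∨ i = 2 then i + 1 else i - 1
  | .B, i => if i = 0 ∨ i = 2 then i - 1 else i + 1

theorem Splice.partner_partner (s : Splice) (i : ZMod 4) : s.partner (s.partner i) = i := by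
  cases s <;> revert i <;> decide

theorem Splice.partner_eq (s : Splice) (i : ZMod 4) :
    s.partner i = i + 1 ∨ i = s.partner i + 1 := by
  cases s <;> revert i <;> decide

namespace DiagramCode

variable (D : DiagramCode)

/-- The orientation of the state circles.  Orient a state circle anticlockwise or clockwise
according to whether it lies inside an even or an odd number of state circles.  Equivalently,
regions inside an odd number of state circles are on the left.  The parity of this number changes
exactly at the arcs of the diagram, for every state, so these regions form one class of the
checkerboard colouring of the faces, and every arc is oriented with a face of this class on its
left.  Hence, for a connected plane diagram, such orientations are the two (depending on the class
of the unbounded face) for which each arc leads from one of its ends to the other and the four arcs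
at a crossing alternately lead away from it and towards it; `out h` says that the arc at `h` leads
away from the crossing of `h`. -/
structure CircleOrientation where
  out : D.X × ZMod 4 → Bool
  out_otherEnd : ∀ h, out (D.otherEnd h) = !out h
  out_next : ∀ x i, out (x, i + 1) = !out (x, i)

namespace CircleOrientation

variable {D} (o : D.CircleOrientation)

theorem out_opp (h : D.X × ZMod 4) : o.out (opp h) = o.out h := by
  have h1 := o.out_next h.1 h.2
  have h2 := o.out_next h.1 (h.2 + 1)
  rw [add_assoc, one_add_one_eq_two, h1] at h2
  simpa [opp] using h2

theorem out_partner (s : D.X → Splice) (h : D.X × ZMod 4) :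
    o.out (h.1, (s h.1).partner h.2) = !o.out h := by
  rcases (s h.1).partner_eq h.2 with e | e
  · rw [e, o.out_next]
  · have := o.out_next h.1 ((s h.1).partner h.2)
    rw [← e] at this
    rw [show h = (h.1, h.2) from rfl, this]; simp

end CircleOrientation

/-- A planar diagram has a checkerboard orientation, so the definitions below are never void. -/
theorem nonempty_circleOrientation (hD : D.IsPlanar) : Nonempty D.CircleOrientation := by
  classical
  have hXf := D.finX
  have hZ : Finite (ZMod 4) := inferInstanceAs (Finite (Fin 4))
  let _ : Fintype (ZMod 4) := inferInstanceAs (Fintype (Fin 4))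
  let _ : Fintype D.X := Fintype.ofFinite _
  let Q := Quotient (Equiv.Perm.SameCycle.setoid D.arcPerm)
  let F := Quotient (Equiv.Perm.SameCycle.setoid D.facePerm)
  let K := Quot D.Adj
  let _ : Fintype Q := Fintype.ofFinite _
  let _ : Fintype F := Fintype.ofFinite _
  let _ : Fintype K := Fintype.ofFinite _
  let qm : D.X × ZMod 4 → Q := fun h => Quotient.mk (Equiv.Perm.SameCycle.setoid D.arcPerm) h
  let fm : D.X × ZMod 4 → F := fun h => Quotient.mk (Equiv.Perm.SameCycle.setoid D.facePerm) h
  have harc : ∀ h, D.arcPerm h = D.otherEnd h := fun h => rfl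
  have hq : ∀ h, qm (D.otherEnd h) = qm h := fun h => by
    refine Quotient.sound (?_ : D.arcPerm.SameCycle _ _)
    exact ⟨1, by simp [harc, D.otherEnd_involutive h]⟩
  have hf : ∀ h, fm ((D.otherEnd h).1, (D.otherEnd h).2 - 1) = fm h := fun h => by
    refine Quotient.sound (?_ : D.facePerm.SameCycle _ _)
    have : D.facePerm h = ((D.otherEnd h).1, (D.otherEnd h).2 - 1) := rfl
    rw [← this]
    exact Equiv.Perm.sameCycle_apply_left.mpr (Equiv.Perm.SameCycle.refl _ _)
  have hqq : ∀ h h', qm h = qm h' → h' = h ∨ h' = D.otherEnd h := by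
    intro h h' e
    obtain ⟨n, hn⟩ : D.arcPerm.SameCycle h h' := Quotient.exact e
    have hsq : D.arcPerm ^ 2 = 1 := by
      ext1 t
      simp [pow_two, harc, D.otherEnd_involutive t]
    rcases Int.even_or_odd' n with ⟨m, rfl | rfl⟩
    · left
      rw [zpow_mul] at hn
      have : D.arcPerm ^ (2 : ℤ) = 1 := by exact_mod_cast hsq
      rw [this] at hn; simpa using hn.symm
    · right
      rw [zpow_add, zpow_mul] at hn
      have : D.arcPerm ^ (2 : ℤ) = 1 := by exact_mod_cast hsq
      rw [this] at hn; simpa [harc] using hn.symm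
  -- coboundary from functions on crossings to functions on arcs
  let d : (D.X → ZMod 2) →ₗ[ZMod 2] (Q → ZMod 2) :=
    { toFun := fun ψ q => ∑ h : D.X × ZMod 4, if qm h = q then ψ h.1 else 0
      map_add' := fun a b => by
        ext q; simp only [Pi.add_apply, ← Finset.sum_add_distrib]
        exact Finset.sum_congr rfl fun h _ => by split_ifs <;> simp
      map_smul' := fun a b => by
        ext q; simp only [Pi.smul_apply, smul_eq_mul, RingHom.id_apply, Finset.mul_sum]
        exact Finset.sum_congr rfl fun h _ => by split_ifs <;> simp }
  obtain ⟨M, hMd⟩ : ∃ M : Matrix Q D.X (ZMod 2), M = LinearMap.toMatrix' d := ⟨_, rfl⟩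
  have hdsum : ∀ ψ h, d ψ (qm h) = ψ h.1 + ψ (D.otherEnd h).1 := by
    intro ψ h
    have : (Finset.univ.filter fun t => qm t = qm h) = {h, D.otherEnd h} := by
      ext t; simp only [Finset.mem_filter, Finset.mem_univ, true_and, Finset.mem_insert,
        Finset.mem_singleton]
      refine ⟨fun e => hqq h t e.symm, ?_⟩
      rintro (rfl | rfl)
      · rfl
      · exact hq h
    show (∑ t : D.X × ZMod 4, if qm t = qm h then ψ t.1 else 0) = _
    rw [← Finset.sum_filter, this, Finset.sum_pair (D.otherEnd_ne h).symm]
  have hMt : ∀ g x, (Matrix.mulVecLin M.transpose g) x = ∑ i : ZMod 4, g (qm (x, i)) := by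
    intro g x
    simp only [Matrix.mulVecLin_apply, Matrix.mulVec, dotProduct, Matrix.transpose_apply]
    have hM : ∀ q, M q x = ∑ i : ZMod 4, if qm (x, i) = q then 1 else 0 := by
      intro q
      rw [hMd, LinearMap.toMatrix'_apply]
      show (∑ t : D.X × ZMod 4,
        if qm t = q then (Pi.single x (1 : ZMod 2) : D.X → ZMod 2) t.1 else 0) = _
      rw [Fintype.sum_prod_type, Finset.sum_eq_single x]
      · simp
      · intro y _ hy; simp [hy]
      · simp
    simp only [hM, Finset.sum_mul]
    rw [Finset.sum_comm]
    refine Finset.sum_congr rfl fun i _ => ?_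
    rw [Finset.sum_eq_single (qm (x, i)) (fun q _ hq' => by rw [if_neg (Ne.symm hq'), zero_mul])
      (fun h => absurd (Finset.mem_univ _) h), if_pos rfl, one_mul]
  -- coboundary from functions on faces to functions on arcs
  let δ : (F → ZMod 2) →ₗ[ZMod 2] (Q → ZMod 2) :=
    { toFun := fun φ q => ∑ h : D.X × ZMod 4, if qm h = q then φ (fm h) else 0
      map_add' := fun a b => by
        ext q; simp only [Pi.add_apply, ← Finset.sum_add_distrib]
        exact Finset.sum_congr rfl fun h _ => by split_ifs <;> simp
      map_smul' := fun a b => by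
        ext q; simp only [Pi.smul_apply, smul_eq_mul, RingHom.id_apply, Finset.mul_sum]
        exact Finset.sum_congr rfl fun h _ => by split_ifs <;> simp }
  have hfm : ∀ h, fm (D.otherEnd h) = fm (h.1, h.2 - 1) := fun h => by
    have := hf (D.otherEnd h)
    rw [D.otherEnd_involutive h] at this
    exact this.symm
  have hδsum : ∀ φ h, δ φ (qm h) = φ (fm h) + φ (fm (h.1, h.2 - 1)) := by
    intro φ h
    have : (Finset.univ.filter fun t => qm t = qm h) = {h, D.otherEnd h} := by
      ext t; simp only [Finset.mem_filter, Finset.mem_univ, true_and, Finset.mem_insert,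
        Finset.mem_singleton]
      refine ⟨fun e => hqq h t e.symm, ?_⟩
      rintro (rfl | rfl)
      · rfl
      · exact hq h
    show (∑ t : D.X × ZMod 4, if qm t = qm h then φ (fm t) else 0) = _
    rw [← Finset.sum_filter, this, Finset.sum_pair (D.otherEnd_ne h).symm, hfm]
  -- kernels
  have hz2 : ∀ a b : ZMod 2, a + b = 0 → a = b := by decide
  let pX : (K → ZMod 2) →ₗ[ZMod 2] (D.X → ZMod 2) := LinearMap.funLeft _ _ (Quot.mk D.Adj)
  have hotherEnd : ∀ h h', D.label h = D.label h' → h' = h ∨ h' = D.otherEnd h := by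
    intro h h' e
    by_cases hh : h' = h
    · exact Or.inl hh
    · exact Or.inr ((D.existsUnique_otherEnd h).unique ⟨hh, e.symm⟩
        ⟨D.otherEnd_ne h, D.label_otherEnd h⟩)
  have hkerd : LinearMap.ker d ≤ LinearMap.range pX := by
    intro ψ hψ
    rw [LinearMap.mem_ker] at hψ
    refine ⟨Quot.lift ψ ?_, by ext x; rfl⟩
    rintro x y ⟨i, j, e⟩
    rcases hotherEnd _ _ e with e' | e'
    · exact congrArg ψ (congrArg Prod.fst e').symm
    · have := hdsum ψ (x, i)
      rw [hψ, ← e'] at this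
      exact hz2 _ _ this.symm
  have hkerd' : Module.finrank (ZMod 2) (LinearMap.ker d) ≤ Fintype.card K :=
    (Submodule.finrank_mono hkerd).trans
      ((LinearMap.finrank_range_le pX).trans (by simp))
  have hkerδ : ∀ φ, δ φ = 0 → ∀ x i j, φ (fm (x, i)) = φ (fm (x, j)) := by
    intro φ hφ x
    have h1 : ∀ i, φ (fm (x, i)) = φ (fm (x, i - 1)) := fun i => by
      have := hδsum φ (x, i)
      rw [hφ] at this
      exact hz2 _ _ this.symm
    have h0 : ∀ n : ℕ, φ (fm (x, (n : ZMod 4))) = φ (fm (x, 0)) := by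
      intro n
      induction n with
      | zero => simp
      | succ n ih => rw [h1]; simpa using ih
    have h2 : ∀ i, φ (fm (x, i)) = φ (fm (x, 0)) := fun i => by
      have := h0 i.val
      rwa [ZMod.natCast_zmod_val] at this
    intro i j; rw [h2 i, h2 j]
  let r : (F → ZMod 2) →ₗ[ZMod 2] (D.X → ZMod 2) := LinearMap.funLeft _ _ (fun x => fm (x, 0))
  have hkr : Module.finrank (ZMod 2) (LinearMap.ker δ) ≤ Fintype.card K := by
    have hinj : Function.Injective (r.comp (LinearMap.ker δ).subtype) := by
      rw [injective_iff_map_eq_zero]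
      rintro ⟨φ, hφ⟩ h0
      apply Subtype.ext
      funext a
      induction a using Quotient.inductionOn with
      | h a =>
        have h1 := congrFun h0 a.1
        have h2 := hkerδ φ hφ a.1 a.2 0
        exact h2.trans h1
    have hle : LinearMap.range (r.comp (LinearMap.ker δ).subtype) ≤ LinearMap.range pX := by
      rintro _ ⟨⟨φ, hφ⟩, rfl⟩
      refine ⟨Quot.lift (fun x => φ (fm (x, 0))) ?_, by ext x; rfl⟩
      rintro x y ⟨i, j, e⟩
      show φ (fm (x, 0)) = φ (fm (y, 0))
      rcases hotherEnd _ _ e with e' | e'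
      · obtain rfl : y = x := congrArg Prod.fst e'
        rfl
      · rw [hkerδ φ hφ y 0 j, e', hfm]
        exact hkerδ φ hφ x _ _
    rw [← LinearMap.finrank_range_of_inj hinj]
    exact (Submodule.finrank_mono hle).trans
      ((LinearMap.finrank_range_le pX).trans (by simp))
  -- the image of `δ` is the kernel of the transpose of `d`
  have hle : LinearMap.range δ ≤ LinearMap.ker (Matrix.mulVecLin M.transpose) := by
    rintro _ ⟨φ, rfl⟩
    rw [LinearMap.mem_ker]
    funext x
    rw [hMt]
    simp only [hδsum, Finset.sum_add_distrib]
    have : ∑ i : ZMod 4, φ (fm (x, i - 1)) = ∑ i : ZMod 4, φ (fm (x, i)) :=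
      (Equiv.subRight (1 : ZMod 4)).sum_comp fun i => φ (fm (x, i))
    rw [this]
    exact CharTwo.add_self_eq_zero _
  have hd1 := LinearMap.finrank_range_add_finrank_ker d
  have hd2 := LinearMap.finrank_range_add_finrank_ker δ
  have hd3 := LinearMap.finrank_range_add_finrank_ker (Matrix.mulVecLin M.transpose)
  have hrank : Module.finrank (ZMod 2) (LinearMap.range (Matrix.mulVecLin M.transpose)) =
      Module.finrank (ZMod 2) (LinearMap.range d) := by
    have h1 : M.mulVecLin = d := by
      rw [← Matrix.toLin'_apply', hMd]; exact Matrix.toLin'_toMatrix' d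
    rw [← h1]
    exact Matrix.rank_transpose M
  have hEuler : (Fintype.card D.X : ℤ) - Fintype.card Q + Fintype.card F = 2 * Fintype.card K := by
    have := hD
    simp only [DiagramCode.IsPlanar, numCycles, Nat.card_eq_fintype_card] at this
    convert this
  simp only [Module.finrank_fintype_fun_eq_card] at hd1 hd2 hd3
  have heq : LinearMap.range δ = LinearMap.ker (Matrix.mulVecLin M.transpose) :=
    Submodule.eq_of_le_of_finrank_le hle (by omega)
  have hone : (fun _ => 1 : Q → ZMod 2) ∈ LinearMap.range δ := by
    rw [heq, LinearMap.mem_ker]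
    funext x
    rw [hMt]
    simp only [Finset.sum_const, Finset.card_univ]
    have : Fintype.card (ZMod 4) = 4 := ZMod.card 4
    rw [this]; rfl
  obtain ⟨φ, hφ⟩ := hone
  have hstep : ∀ h : D.X × ZMod 4, φ (fm h) + φ (fm (h.1, h.2 - 1)) = 1 := fun h => by
    rw [← hδsum, hφ]
  have hb : ∀ a b : ZMod 2, a + b = 1 → decide (b = 1) = !decide (a = 1) := by decide
  refine ⟨⟨fun h => decide (φ (fm h) = 1), fun h => ?_, fun x i => ?_⟩⟩
  · show decide (φ (fm (D.otherEnd h)) = 1) = !decide (φ (fm h) = 1)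
    rw [hfm]
    exact hb _ _ (hstep h)
  · have := hstep (x, i + 1)
    simp only [add_sub_cancel_right] at this
    rw [add_comm] at this
    exact hb _ _ this

/-- Splicing all crossings according to the state `s`, each end is joined with its partner. -/
def splicePerm (s : D.X → Splice) : Equiv.Perm (D.X × ZMod 4) :=
  Function.Involutive.toPerm (fun h => (h.1, (s h.1).partner h.2))
    (fun h => by simp [Splice.partner_partner])

/-- Passing to the opposite end at a crossing. -/
def oppPerm : Equiv.Perm (D.X × ZMod 4) :=
  Function.Involutive.toPerm opp
    (fun h => by
      have : ∀ i : ZMod 4, i + 2 + 2 = i := by decide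
      simp [opp, this])

/-- Passing along an arc and through the next spliced crossing, as a permutation of the ends at which
the oriented state circles leave a crossing. -/
noncomputable def circlePerm (o : D.CircleOrientation) (s : D.X → Splice) :
    Equiv.Perm {h : D.X × ZMod 4 // o.out h = true} :=
  (D.splicePerm s * D.arcPerm).subtypePerm fun h => by
    have h1 : o.out ((D.splicePerm s * D.arcPerm) h) = !o.out (D.otherEnd h) :=
      o.out_partner s (D.otherEnd h)
    rw [h1, o.out_otherEnd, Bool.not_not]

/-- Passing to the opposite end, as a permutation of the same set. -/
def crossPerm (o : D.CircleOrientation) : Equiv.Perm {h : D.X × ZMod 4 // o.out h = true} :=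
  D.oppPerm.subtypePerm fun h => by
    have h1 : o.out (D.oppPerm h) = o.out h := o.out_opp h
    rw [h1]

/-- The ribbon graph `𝔻(s)` of a state `s`.  A half-edge is a splicing arc at a crossing `x`,
directed away from the piece of state circle where it starts; there are two at each crossing.  This
piece of state circle joins two neighbouring ends at `x`, and the half-edge is recorded by the one at
which the state circle leaves `x`.  So `σ₀` follows the state circle along an arc of the diagram to
the next crossing and through the spliced crossing, `σ₁` passes to the other side of the splice.
Closed curves without crossings are state circles without splicing arcs. -/
noncomputable def stateRibbonGraph (o : D.CircleOrientation) (s : D.X → Splice) : RibbonGraph where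
  B := {h : D.X × ZMod 4 // o.out h = true}
  finB := by
    have := D.finX
    have : Finite (ZMod 4) := inferInstanceAs (Finite (Fin 4))
    infer_instance
  σ₀ := D.circlePerm o s
  σ₁ := D.crossPerm o
  σ₂ := (D.circlePerm o s * D.crossPerm o)⁻¹
  σ₁_invol := fun b => by
    apply Subtype.ext
    show opp (opp b.1) = b.1
    have : ∀ i : ZMod 4, i + 2 + 2 = i := by decide
    simp [opp, this]
  σ₁_ne := fun b hb => by
    have h1 : opp b.1 = b.1 := congrArg Subtype.val hb
    have h2 : b.1.2 + 2 = b.1.2 := congrArg Prod.snd h1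
    have : ∀ i : ZMod 4, i + 2 ≠ i := by decide
    exact this _ h2
  σ_mul := fun b => (D.circlePerm o s * D.crossPerm o).apply_symm_apply b
  isolated := {a | ∀ h, D.label h ≠ a}.ncard

/-- The ribbon graph `𝔻(A)` of the state with only `A`-splices. -/
noncomputable def ribbonA (o : D.CircleOrientation) : RibbonGraph :=
  D.stateRibbonGraph o fun _ => .A

/-- The ribbon graph `𝔻(B)` of the state with only `B`-splices. -/
noncomputable def ribbonB (o : D.CircleOrientation) : RibbonGraph :=
  D.stateRibbonGraph o fun _ => .B

/-- The diagram is adequate if neither `𝔻(A)` nor `𝔻(B)` has a loop. -/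
def IsAdequate : Prop :=
  ∀ o : D.CircleOrientation, (D.ribbonA o).Loopless ∧ (D.ribbonB o).Loopless

end DiagramCode

/-! Let a connected diagram have `c` crossings and `s_A`, `s_B` state circles in its two extreme
states. The vertices of `𝔻(A)` are the `A`-circles, its faces are the `B`-circles and its edges are
the crossings; for `𝔻(B)` the circles change roles. Hence both genera equal `(2 - s_A - s_B + c) /
2` (`genus_stateRibbonGraph`), and it suffices that `c` and `s_A + s_B` depend only on the link when
the diagram is adequate (`card_eq_of_link_eq`).

Both numbers are read off from the growth of two link invariants, evaluated at `n = 2 ^ (k + 2)`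
instead of being treated as polynomials. The Kauffman bracket with loop value `n` is a sum over
colourings of the arcs by a group of order `n` and exponent two; a specialisation of the Yamada
polynomial is a sum over nowhere zero flows in the same group. The third Reidemeister move preserves
such a sum, the second one preserves it up to sign, and a kink contributes a factor. Exchanging
upper and lower strands inverts this factor up to sign, so the absolute value of the product of the
sum and the swapped sum is a link invariant (`abs_partition_mul_eq_of_link_eq`).

Expand every crossing into its two splices and, for flows, a 4-valent vertex. The all-`A` state
contributes `λ ^ c * m ^ s_A`, where `λ` is the weight of the `A`-splice and `m` the number of
colours. If other markers occur exactly on a nonempty set `S`, the colourings fit the `A`-splice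
outside `S` and have vanishing sum at the crossings in `S`. Each crossing of `S` multiplies their
number by at most `n`, but the first one adds nothing, because adequacy puts its two pieces of state
circle on different circles (`card_isColoring_le`). As the other weights are at most `4 * λ / n`,
all other states together are smaller by a factor `n`, up to a constant (`abs_partition_sub_le`).
The swapped sum behaves likewise with `B`. Now `λ ^ 2` grows like `n` for the bracket and like `n ^
2` for flows, so the two invariants grow like `n ^ (c + s_A + s_B)` and `n ^ (2 * c + s_A + s_B)`;
these exponents determine `c` and `s_A + s_B`. -/

/-! ### State sums of vertex models -/

namespace VertexSum

/-- Whether an end belongs to the lower strand. -/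
def isLower (i : ZMod 4) : Bool := decide (i = 0 ∨ i = 2)

theorem isLower_add_one (i : ZMod 4) : isLower (i + 1) = !isLower i := by
  revert i; decide

theorem sameLevel_iff (i j : ZMod 4) : SameLevel i j ↔ isLower i = isLower j := by
  unfold SameLevel; revert i j; decide

/-- The weight of a crossing with the colours `f`, read from the end `i`. -/
def weightFrom {C : Type} (W : Bool → C → C → C → C → ℝ) (f : ZMod 4 → C) (i : ZMod 4) : ℝ :=
  W (isLower i) (f i) (f (i + 1)) (f (i + 2)) (f (i + 3))

/-- A quarter turn exchanges the levels exactly as `W` prescribes, so every crossing may be read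
from the end that suits the move at hand. -/
theorem weightFrom_eq_zero_end {C : Type} {W : Bool → C → C → C → C → ℝ}
    (hW : ∀ t a b c d, W t a b c d = W (!t) b c d a) (f : ZMod 4 → C) (i : ZMod 4) :
    weightFrom W f i = weightFrom W f 0 := by
  have step : ∀ j, weightFrom W f (j + 1) = weightFrom W f j := fun j => by
    unfold weightFrom
    rw [hW (isLower j), isLower_add_one]
    have h1 : j + 1 + 1 = j + 2 := by revert j; decide
    have h2 : j + 1 + 2 = j + 3 := by revert j; decide
    have h3 : j + 1 + 3 = j := by revert j; decide
    rw [h1, h2, h3]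
  have h : ∀ n : ℕ, weightFrom W f (n : ZMod 4) = weightFrom W f 0 := by
    intro n
    induction n with
    | zero => simp
    | succ n ih => rw [Nat.cast_succ, step, ih]
  have := h i.val
  rwa [ZMod.natCast_zmod_val] at this

/-- The sum over all colourings of the arcs of the product of the weights of the crossings. -/
noncomputable def stateSum {X E C : Type} [Finite X] [Finite E] [Fintype C]
    (W : Bool → C → C → C → C → ℝ) (l : X × ZMod 4 → E) : ℝ :=
  letI := Fintype.ofFinite X
  letI := Fintype.ofFinite E
  letI := Classical.decEq E
  ∑ c : E → C, ∏ x, weightFrom W (fun i => c (l (x, i))) 0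

theorem stateSum_eq {X E C : Type} [Fintype X] [Fintype E] [DecidableEq E] [Fintype C]
    (W : Bool → C → C → C → C → ℝ) (l : X × ZMod 4 → E) :
    stateSum W l = ∑ c : E → C, ∏ x, weightFrom W (fun i => c (l (x, i))) 0 := by
  unfold stateSum
  convert rfl

theorem stateSum_congr {X E X' E' C : Type} [Finite X] [Finite E] [Finite X'] [Finite E']
    [Fintype C] {W : Bool → C → C → C → C → ℝ}
    {l : X × ZMod 4 → E} {l' : X' × ZMod 4 → E'} (p : X ≃ X') (q : E ≃ E') (r : X → ZMod 4)
    (hr : ∀ c : E → C, ∀ x, weightFrom W (fun i => c (q.symm (l' (p x, i)))) 0 =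
      weightFrom W (fun i => c (l (x, i))) (r x))
    (hW : ∀ t a b c d, W t a b c d = W (!t) b c d a) :
    stateSum W l' = stateSum W l := by
  classical
  let _ := Fintype.ofFinite X
  let _ := Fintype.ofFinite E
  let _ := Fintype.ofFinite X'
  let _ := Fintype.ofFinite E'
  rw [stateSum_eq, stateSum_eq]
  refine Fintype.sum_equiv (q.symm.arrowCongr (Equiv.refl C)) _ _ fun c' => ?_
  refine (Fintype.prod_equiv p _ _ fun x => ?_).symm
  rw [← weightFrom_eq_zero_end hW _ (r x), ← hr]
  simp [Equiv.arrowCongr]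

/-! ### Summation over single arcs -/

section Update

variable {E C : Type} [Fintype E] [DecidableEq E] [Fintype C]

/-- Exchanging the colour of `e` with an independent extra colour is an involution on pairs. It
permits summation over one arc without splitting the space of colourings. -/
theorem card_mul_sum (e : E) (F : (E → C) → ℝ) :
    (Fintype.card C : ℝ) * ∑ c, F c = ∑ c, ∑ v, F (Function.update c e v) := by
  let φ : (E → C) × C ≃ (E → C) × C := Function.Involutive.toPerm
    (fun p => (Function.update p.1 e p.2, p.1 e)) (fun p => by simp)
  have h1 : ∑ p : (E → C) × C, F (φ p).1 = ∑ p : (E → C) × C, F p.1 := φ.sum_comp fun p => F p.1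
  rw [Fintype.sum_prod_type, Fintype.sum_prod_type] at h1
  rw [Finset.mul_sum]
  exact (h1.trans (by simp)).symm

theorem sum_eq_of_update [Nonempty C] (e : E) {F G : (E → C) → ℝ}
    (h : ∀ c, ∑ v, F (Function.update c e v) = ∑ v, G (Function.update c e v)) :
    ∑ c, F c = ∑ c, G c := by
  have h0 : (Fintype.card C : ℝ) ≠ 0 := by exact_mod_cast Fintype.card_ne_zero
  refine mul_left_cancel₀ h0 ?_
  rw [card_mul_sum e, card_mul_sum e]
  exact Finset.sum_congr rfl fun c _ => h c

theorem sum_eq_of_update₂ [Nonempty C] (e₁ e₂ : E) {F G : (E → C) → ℝ}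
    (h : ∀ c, ∑ v₁, ∑ v₂, F (Function.update (Function.update c e₁ v₁) e₂ v₂) =
      ∑ v₁, ∑ v₂, G (Function.update (Function.update c e₁ v₁) e₂ v₂)) :
    ∑ c, F c = ∑ c, G c := by
  have h0 : (Fintype.card C : ℝ) ≠ 0 := by exact_mod_cast Fintype.card_ne_zero
  refine mul_left_cancel₀ h0 ?_
  rw [card_mul_sum e₂, card_mul_sum e₂]
  exact sum_eq_of_update e₁ h

theorem sum_eq_of_update₃ [Nonempty C] (e₁ e₂ e₃ : E) {F G : (E → C) → ℝ}
    (h : ∀ c, ∑ v₁, ∑ v₂, ∑ v₃,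
        F (Function.update (Function.update (Function.update c e₁ v₁) e₂ v₂) e₃ v₃) =
      ∑ v₁, ∑ v₂, ∑ v₃,
        G (Function.update (Function.update (Function.update c e₁ v₁) e₂ v₂) e₃ v₃)) :
    ∑ c, F c = ∑ c, G c := by
  have h0 : (Fintype.card C : ℝ) ≠ 0 := by exact_mod_cast Fintype.card_ne_zero
  refine mul_left_cancel₀ h0 ?_
  rw [card_mul_sum e₃, card_mul_sum e₃]
  exact sum_eq_of_update₂ e₁ e₂ h

/-- Colourings of the merged arcs are the colourings that are constant on the fibres of `q`; this
compares a diagram with the one left after erasing crossings. -/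
theorem sum_comp_surjective {E' : Type} [Fintype E'] [DecidableEq E'] [DecidableEq C] {q : E → E'}
    (hq : Function.Surjective q) (P : (E → C) → Prop) [DecidablePred P]
    (hP : ∀ c, P c ↔ ∀ a b, q a = q b → c a = c b) (K : (E → C) → ℝ) :
    ∑ c' : E' → C, K (c' ∘ q) = ∑ c : E → C, if P c then K c else 0 := by
  rw [← Finset.sum_filter]
  refine Finset.sum_bij (fun c' _ => c' ∘ q) (fun c' _ => ?_) (fun a _ b _ h => ?_)
    (fun c hc => ?_) (fun _ _ => rfl)
  · simp only [Finset.mem_filter, Finset.mem_univ, true_and, hP]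
    intro a b h
    simp [h]
  · exact hq.injective_comp_right h
  · simp only [Finset.mem_filter, Finset.mem_univ, true_and, hP] at hc
    refine ⟨fun a' => c (hq a').choose, Finset.mem_univ _, ?_⟩
    funext a
    exact hc _ _ (hq (q a)).choose_spec

end Update

end VertexSum

/-! ### Vertex models -/

/-- Weights of crossings that make the state sum an invariant of framed links up to a factor.
`W t` is the weight of a crossing read counterclockwise from an end, which belongs to the lower
strand if and only if `t` is true. -/
structure VertexModel (C : Type) [Fintype C] [DecidableEq C] where
  W : Bool → C → C → C → C → ℝ
  κ : Bool → ℝ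
  ε : ℝ
  rotate : ∀ t a b c d, W t a b c d = W (!t) b c d a
  kink : ∀ t a b, ∑ e, W t e e a b = if a = b then κ t else 0
  bigon : ∀ t a b a' b', ∑ e, ∑ e', W t e e' a b * W t e b' a' e' =
    if a = a' ∧ b = b' then ε else 0
  triangle : ∀ t x₂ x₃ y₂ y₃ z₂ z₃,
    ∑ e₁, ∑ e₂, ∑ e₃, W t e₁ e₃ x₂ x₃ * W t e₂ e₁ y₂ y₃ * W (!t) e₃ e₂ z₂ z₃ =
    ∑ e₁, ∑ e₂, ∑ e₃, W t y₃ z₂ e₁ e₃ * W t z₃ x₂ e₂ e₁ * W (!t) x₃ y₂ e₃ e₂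

namespace VertexModel

open VertexSum

variable {C : Type} [Fintype C] [DecidableEq C]

/-- The model with upper and lower strands exchanged. -/
def swap (M : VertexModel C) : VertexModel C where
  W t := M.W (!t)
  κ t := M.κ (!t)
  ε := M.ε
  rotate t := M.rotate (!t)
  kink t := M.kink (!t)
  bigon t := M.bigon (!t)
  triangle t := M.triangle (!t)

/-- If three levels are not all equal, exactly one differs from the other two. Cyclic symmetry of
the triangle moves it to the last place, the only case that a model has to provide. -/
theorem triangle_of_ne (M : VertexModel C) {s t u : Bool} (h : ¬ (s = t ∧ t = u))
    (x₂ x₃ y₂ y₃ z₂ z₃ : C) :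
    ∑ e₁, ∑ e₂, ∑ e₃, M.W s e₁ e₃ x₂ x₃ * M.W t e₂ e₁ y₂ y₃ * M.W u e₃ e₂ z₂ z₃ =
    ∑ e₁, ∑ e₂, ∑ e₃, M.W s y₃ z₂ e₁ e₃ * M.W t z₃ x₂ e₂ e₁ * M.W u x₃ y₂ e₃ e₂ := by
  have rot : ∀ f : C → C → C → ℝ,
      ∑ e₁, ∑ e₂, ∑ e₃, f e₁ e₂ e₃ = ∑ e₂, ∑ e₃, ∑ e₁, f e₁ e₂ e₃ := fun f => by
    rw [Finset.sum_comm]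
    exact Finset.sum_congr rfl fun _ _ => Finset.sum_comm
  by_cases hst : s = t
  · subst hst
    obtain rfl : u = !s := by
      have : s ≠ u := fun hh => h ⟨rfl, hh⟩
      revert this; revert s u; decide
    exact M.triangle s x₂ x₃ y₂ y₃ z₂ z₃
  · by_cases htu : t = u
    · subst htu
      obtain rfl : s = !t := by revert hst; revert s t; decide
      refine (rot _).trans (Eq.trans ?_ (rot _).symm)
      refine Eq.trans ?_ ((M.triangle t y₂ y₃ z₂ z₃ x₂ x₃).trans ?_) <;>
      · refine Finset.sum_congr rfl fun _ _ => Finset.sum_congr rfl fun _ _ =>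
          Finset.sum_congr rfl fun _ _ => ?_
        ring
    · obtain rfl : u = s := by revert hst htu; revert s t u; decide
      obtain rfl : t = !u := by revert hst; revert u t; decide
      refine ((rot _).trans (rot _)).trans (Eq.trans ?_ ((rot _).trans (rot _)).symm)
      refine Eq.trans ?_ ((M.triangle u z₂ z₃ x₂ x₃ y₂ y₃).trans ?_) <;>
      · refine Finset.sum_congr rfl fun _ _ => Finset.sum_congr rfl fun _ _ =>
          Finset.sum_congr rfl fun _ _ => ?_
        ring

/-- The state sum of a diagram. -/
noncomputable def partition (M : VertexModel C) (D : DiagramCode) : ℝ :=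
  have := D.finX
  have := D.finE
  stateSum M.W D.label

theorem partition_iso (M : VertexModel C) {D D' : LinkDiagram} (h : D.Iso D') :
    M.partition D.toDiagramCode = M.partition D'.toDiagramCode := by
  obtain ⟨p, q, r, hr, hl⟩ := h
  have := D.finX
  have := D.finE
  have := D'.finX
  have := D'.finE
  refine (stateSum_congr p q r (fun c x => ?_) M.rotate).symm
  have hl' : ∀ i, q.symm (D'.label (p x, i)) = D.label (x, i + r x) := fun i => by
    rw [Equiv.symm_apply_eq, ← hl]
    congr 2
    rcases hr x with h | h <;> rw [h] <;> revert i <;> decide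
  simp only [hl', weightFrom]
  rcases hr x with h | h <;> rw [h]
  · simp
  · have h1 : (1 + 2 : ZMod 4) = 2 + 1 := by decide
    have h2 : (3 + 2 : ZMod 4) = 2 + 3 := by decide
    simp only [zero_add, h1, h2]
    rfl

end VertexModel


/-! ### Invariance of state sums under the Reidemeister moves -/

namespace DiagramCode

theorem eq_or_eq_of_label_eq (D : DiagramCode) {h h' k : D.X × ZMod 4}
    (hh : D.label h = D.label h') (hne : h ≠ h') (hk : D.label k = D.label h) :
    k = h ∨ k = h' := by
  by_cases e : k = h
  · exact Or.inl e
  · exact Or.inr ((D.existsUnique_otherEnd h).unique ⟨e, hk⟩ ⟨hne.symm, hh.symm⟩)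

end DiagramCode

namespace VertexSum

theorem ne_add_one (m : ZMod 4) : m ≠ m + 1 := by revert m; decide

theorem add_two_ne (m : ZMod 4) : m + 2 ≠ m ∧ m + 2 ≠ m + 1 ∧ m + 2 ≠ m + 3 := by
  revert m; decide

theorem add_three_ne (m : ZMod 4) : m + 3 ≠ m ∧ m + 3 ≠ m + 1 := by revert m; decide

theorem forall_eq_add_two_iff {C : Type} (f : ZMod 4 → C) (i : ZMod 4) :
    (∀ j, f j = f (j + 2)) ↔ f i = f (i + 2) ∧ f (i + 1) = f (i + 3) := by
  have h3 : i + 1 + 2 = i + 3 := by revert i; decide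
  have h4 : i + 2 + 2 = i := by revert i; decide
  have h5 : i + 3 + 2 = i + 1 := by revert i; decide
  constructor
  · intro h
    exact ⟨h i, h3 ▸ h (i + 1)⟩
  · rintro ⟨h1, h2⟩ j
    have hj : ∀ i j : ZMod 4, j = i ∨ j = i + 1 ∨ j = i + 2 ∨ j = i + 3 := by decide
    rcases hj i j with rfl | rfl | rfl | rfl
    · exact h1
    · rw [h3]; exact h2
    · rw [h4]; exact h1.symm
    · rw [h5]; exact h2.symm

end VertexSum

namespace VertexModel

open VertexSum

variable {C : Type} [Fintype C] [DecidableEq C]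

section Fintype

variable (M : VertexModel C)

-- Separates the crossings `S` of a move, each read from a chosen end, from the untouched rest.
open Classical in
theorem partition_eq (D : DiagramCode) [Fintype D.X] [Fintype D.E] (r : D.X → ZMod 4)
    (S : Finset D.X) : M.partition D = ∑ c : D.E → C,
      (∏ x ∈ Sᶜ, weightFrom M.W (fun i => c (D.label (x, i))) 0) *
        ∏ x ∈ S, weightFrom M.W (fun i => c (D.label (x, i))) (r x) := by
  unfold partition
  rw [stateSum_eq]
  refine Finset.sum_congr rfl fun c _ => ?_
  rw [← Finset.prod_compl_mul_prod S]
  congr 1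
  exact Finset.prod_congr rfl fun x _ => (weightFrom_eq_zero_end M.rotate _ _).symm

-- Colourings of the erased diagram are those of the old one whose opposite ends agree at `S`, so
-- both state sums run over the same arcs.
open Classical in
theorem partition_of_erase {D D' : LinkDiagram} [Fintype D.X] [Fintype D.E] {S : Finset D.X}
    (h : D.Erase (S : Set D.X) D') : M.partition D'.toDiagramCode = ∑ c : D.E → C,
      if (∀ x ∈ S, ∀ i, c (D.label (x, i)) = c (D.label (x, i + 2))) then
        ∏ x ∈ Sᶜ, weightFrom M.W (fun i => c (D.label (x, i))) 0 else 0 := by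
  obtain ⟨p, q, hq, hqq, hl⟩ := h
  have := D'.finX
  have := D'.finE
  let _ := Fintype.ofFinite D'.X
  let _ := Fintype.ofFinite D'.E
  rw [partition, stateSum_eq, ← sum_comp_surjective hq (fun c : D.E → C =>
    ∀ x ∈ S, ∀ i, c (D.label (x, i)) = c (D.label (x, i + 2)))
    (K := fun c => ∏ x ∈ Sᶜ, weightFrom M.W (fun i => c (D.label (x, i))) 0)]
  · refine Finset.sum_congr rfl fun c _ => ?_
    rw [Finset.prod_subtype Sᶜ (p := fun x => x ∉ (S : Set D.X)) (by simp)]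
    refine Fintype.prod_equiv p _ _ fun x => ?_
    simp [hl]
  · intro c
    constructor
    · intro hc a b hab
      rw [hqq] at hab
      induction hab with
      | rel a b h =>
        obtain ⟨x, hx, i, rfl, rfl⟩ := h
        exact hc x hx i
      | refl => rfl
      | symm _ _ _ ih => exact ih.symm
      | trans _ _ _ _ _ ih ih' => exact ih.trans ih'
    · intro hc x hx i
      refine hc _ _ ((hqq _ _).mpr (Relation.EqvGen.rel _ _ ⟨x, hx, i, rfl, rfl⟩))

end Fintype

theorem partition_moveI [Nonempty C] {D D' : LinkDiagram} {x : D.X} {i : ZMod 4}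
    (hi : D.label (x, i) = D.label (x, i + 1)) (hE : D.Erase {x} D') (M : VertexModel C) :
    M.partition D.toDiagramCode = M.κ (isLower i) * M.partition D'.toDiagramCode := by
  classical
  have := D.finX
  have := D.finE
  let _ := Fintype.ofFinite D.X
  let _ := Fintype.ofFinite D.E
  rw [M.partition_eq D.toDiagramCode (fun _ => i) {x},
    M.partition_of_erase (S := {x}) (by simpa using hE), Finset.mul_sum]
  have hends : ∀ y m, D.label (y, m) = D.label (x, i) → y = x ∧ (m = i ∨ m = i + 1) := by
    intro y m h
    rcases D.eq_or_eq_of_label_eq hi (by simpa using ne_add_one i) h with h | h <;> simp_all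
  have ha : D.label (x, i + 2) ≠ D.label (x, i) := fun h => by
    rcases (hends _ _ h).2 with h | h
    · exact (add_two_ne i).1 h
    · exact (add_two_ne i).2.1 h
  have hb : D.label (x, i + 3) ≠ D.label (x, i) := fun h => by
    rcases (hends _ _ h).2 with h | h
    · exact (add_three_ne i).1 h
    · exact (add_three_ne i).2 h
  refine sum_eq_of_update (D.label (x, i)) fun c => ?_
  obtain ⟨K, hK⟩ : ∃ K, K = ∏ y ∈ ({x} : Finset D.X)ᶜ,
      weightFrom M.W (fun m => c (D.label (y, m))) 0 := ⟨_, rfl⟩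
  obtain ⟨u, hu⟩ : ∃ u : C → D.E → C, ∀ v, Function.update c (D.label (x, i)) v = u v :=
    ⟨_, fun _ => rfl⟩
  have hrest : ∀ v, ∏ y ∈ ({x} : Finset D.X)ᶜ,
      weightFrom M.W (fun m => u v (D.label (y, m))) 0 = K := by
    intro v
    rw [hK]
    refine Finset.prod_congr rfl fun y hy => ?_
    have hy' : y ≠ x := by simpa using hy
    have : ∀ m, u v (D.label (y, m)) = c (D.label (y, m)) :=
      fun m => by rw [← hu, Function.update_of_ne fun h => hy' (hends y m h).1]
    simp only [this]
  have e0 : ∀ v, u v (D.label (x, i)) = v := fun v => by rw [← hu, Function.update_self]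
  have e1 : ∀ v, u v (D.label (x, i + 2)) = c (D.label (x, i + 2)) := fun v => by
    rw [← hu, Function.update_of_ne ha]
  have e2 : ∀ v, u v (D.label (x, i + 3)) = c (D.label (x, i + 3)) := fun v => by
    rw [← hu, Function.update_of_ne hb]
  simp only [hu, hrest]
  simp only [Finset.prod_singleton, Finset.mem_singleton, forall_eq,
    fun v => forall_eq_add_two_iff (fun j => u v (D.label (x, j))) i, weightFrom, ← hi,
    e0, e1, e2]
  rw [← Finset.mul_sum, M.kink]
  by_cases hab : c (D.label (x, i + 2)) = c (D.label (x, i + 3))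
  · simp [hab, mul_comm]
  · rw [if_neg hab, mul_zero]
    -- On the erased side the loop colour would have to equal the colours of both outer ends, which
    -- differ.
    symm
    refine Finset.sum_eq_zero fun v _ => ?_
    rw [if_neg, mul_zero]
    rintro ⟨rfl, h⟩
    exact hab h

theorem partition_moveII [Nonempty C] {D D' : LinkDiagram} (h : D.MoveII D') (M : VertexModel C) :
    M.partition D.toDiagramCode = M.ε * M.partition D'.toDiagramCode := by
  classical
  obtain ⟨x, y, i, j, hxy, hij, h1, h2, hE⟩ := h
  have := D.finX
  have := D.finE
  let _ := Fintype.ofFinite D.X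
  let _ := Fintype.ofFinite D.E
  rw [sameLevel_iff] at hij
  have hj3 : j - 1 = j + 3 := (by decide : ∀ j : ZMod 4, j - 1 = j + 3) j
  rw [hj3] at h2
  rw [M.partition_eq D.toDiagramCode (fun z => if z = x then i else j) {x, y},
    M.partition_of_erase (S := {x, y}) (by simpa using hE), Finset.mul_sum]
  have hends1 : ∀ z m, D.label (z, m) = D.label (x, i) → z = x ∧ m = i ∨ z = y ∧ m = j := by
    intro z m h
    rcases D.eq_or_eq_of_label_eq h1 (by simp [hxy]) h with h | h <;> simp_all
  have hends2 : ∀ z m, D.label (z, m) = D.label (x, i + 1) →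
      z = x ∧ m = i + 1 ∨ z = y ∧ m = j + 3 := by
    intro z m h
    rcases D.eq_or_eq_of_label_eq h2 (by simp [hxy]) h with h | h <;> simp_all
  have hx1 : ∀ m, m ≠ i → D.label (x, m) ≠ D.label (x, i) := fun m hm h => by
    rcases hends1 _ _ h with ⟨-, h⟩ | ⟨h, -⟩ <;> contradiction
  have hx2 : ∀ m, m ≠ i + 1 → D.label (x, m) ≠ D.label (x, i + 1) := fun m hm h => by
    rcases hends2 _ _ h with ⟨-, h⟩ | ⟨h, -⟩ <;> contradiction
  have hy1 : ∀ m, m ≠ j → D.label (y, m) ≠ D.label (x, i) := fun m hm h => by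
    rcases hends1 _ _ h with ⟨h, -⟩ | ⟨-, h⟩
    · exact hxy h.symm
    · contradiction
  have hy2 : ∀ m, m ≠ j + 3 → D.label (y, m) ≠ D.label (x, i + 1) := fun m hm h => by
    rcases hends2 _ _ h with ⟨h, -⟩ | ⟨-, h⟩
    · exact hxy h.symm
    · contradiction
  refine sum_eq_of_update₂ (D.label (x, i)) (D.label (x, i + 1)) fun c => ?_
  obtain ⟨K, hK⟩ : ∃ K, K = ∏ z ∈ ({x, y} : Finset D.X)ᶜ,
      weightFrom M.W (fun m => c (D.label (z, m))) 0 := ⟨_, rfl⟩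
  obtain ⟨u, hu⟩ : ∃ u : C → C → D.E → C, ∀ v₁ v₂, Function.update
      (Function.update c (D.label (x, i)) v₁) (D.label (x, i + 1)) v₂ = u v₁ v₂ :=
    ⟨_, fun _ _ => rfl⟩
  have u0 : ∀ v₁ v₂ z m, D.label (z, m) ≠ D.label (x, i) → D.label (z, m) ≠ D.label (x, i + 1) →
      u v₁ v₂ (D.label (z, m)) = c (D.label (z, m)) := fun v₁ v₂ z m ha hb => by
    rw [← hu, Function.update_of_ne hb, Function.update_of_ne ha]
  have u1 : ∀ v₁ v₂, u v₁ v₂ (D.label (x, i)) = v₁ := fun v₁ v₂ => by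
    rw [← hu, Function.update_of_ne (hx2 i (ne_add_one i)), Function.update_self]
  have u2 : ∀ v₁ v₂, u v₁ v₂ (D.label (x, i + 1)) = v₂ := fun v₁ v₂ => by
    rw [← hu, Function.update_self]
  have hrest : ∀ v₁ v₂, ∏ z ∈ ({x, y} : Finset D.X)ᶜ, weightFrom M.W
      (fun m => u v₁ v₂ (D.label (z, m))) 0 = K := by
    intro v₁ v₂
    rw [hK]
    refine Finset.prod_congr rfl fun z hz => ?_
    have hz' : z ≠ x ∧ z ≠ y := by simpa using hz
    have : ∀ m, u v₁ v₂ (D.label (z, m)) = c (D.label (z, m)) := fun m =>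
      u0 _ _ _ _ (fun h => by rcases hends1 _ _ h with h | h <;> simp_all)
        (fun h => by rcases hends2 _ _ h with h | h <;> simp_all)
    simp only [this]
  have e1 := fun v₁ v₂ => u0 v₁ v₂ x (i + 2) (hx1 _ (add_two_ne i).1) (hx2 _ (add_two_ne i).2.1)
  have e2 := fun v₁ v₂ => u0 v₁ v₂ x (i + 3) (hx1 _ (add_three_ne i).1) (hx2 _ (add_three_ne i).2)
  have e3 := fun v₁ v₂ => u0 v₁ v₂ y (j + 1) (hy1 _ (ne_add_one j).symm)
    (hy2 _ (add_three_ne j).2.symm)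
  have e4 := fun v₁ v₂ => u0 v₁ v₂ y (j + 2) (hy1 _ (add_two_ne j).1) (hy2 _ (add_two_ne j).2.2)
  simp only [hu, hrest]
  simp only [Finset.prod_pair hxy, Finset.mem_insert, Finset.mem_singleton,
    forall_eq_or_imp, forall_eq, if_true, if_neg hxy.symm,
    fun v₁ v₂ => forall_eq_add_two_iff (fun m => u v₁ v₂ (D.label (x, m))) i,
    fun v₁ v₂ => forall_eq_add_two_iff (fun m => u v₁ v₂ (D.label (y, m))) j,
    weightFrom, ← h1, ← h2, e1, e2, e3, e4, u1, u2]
  simp only [← Finset.mul_sum, ← hij]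
  rw [M.bigon]
  by_cases hab : c (D.label (x, i + 2)) = c (D.label (y, j + 2)) ∧
      c (D.label (x, i + 3)) = c (D.label (y, j + 1))
  · rw [if_pos hab, hab.1, hab.2, mul_comm]
    congr 1
    -- After the erasure the two sides of the bigon are parts of the outer strands, so exactly one
    -- pair of colours survives.
    rw [Finset.sum_eq_single (c (D.label (y, j + 2))),
      Finset.sum_eq_single (c (D.label (y, j + 1)))]
    · simp
    · intro v _ hv
      rw [if_neg]
      rintro ⟨⟨-, h⟩, -⟩
      exact hv h
    · simp
    · intro v _ hv
      refine Finset.sum_eq_zero fun v' _ => ?_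
      rw [if_neg]
      rintro ⟨⟨h, -⟩, -⟩
      exact hv h
    · simp
  · rw [if_neg hab, mul_zero]
    symm
    refine mul_eq_zero_of_right _ (Finset.sum_eq_zero fun v _ => Finset.sum_eq_zero fun v' _ => ?_)
    rw [if_neg]
    rintro ⟨⟨rfl, rfl⟩, h3, h4⟩
    exact hab ⟨h3, h4.symm⟩

/-- Pulled back along `p` and `q`, the new labels live on the old crossings and arcs and differ from
the old ones only at the three corners. The sum over the three sides is then the triangle identity.
-/
theorem partition_moveIII [Nonempty C] {D D' : LinkDiagram} (h : D.MoveIII D')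
    (M : VertexModel C) : M.partition D.toDiagramCode = M.partition D'.toDiagramCode := by
  classical
  obtain ⟨p, q, x, y, z, i, j, k, hxy, hyz, hzx, h1, h2, h3, hlev, hs1, hs2, hs3, hrest'⟩ := h
  have := D.finX
  have := D.finE
  have := D'.finX
  have := D'.finE
  let _ := Fintype.ofFinite D.X
  let _ := Fintype.ofFinite D.E
  rw [sameLevel_iff, sameLevel_iff] at hlev
  set l' : D.X × ZMod 4 → D.E := fun h => q.symm (D'.label (p h.1, h.2)) with hl'
  have hZ : M.partition D'.toDiagramCode = stateSum M.W l' := by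
    refine stateSum_congr p q (fun _ => 0) (fun c x => rfl) M.rotate
  have conv : ∀ h k, D'.label (p h.1, h.2) = q (D.label k) → l' h = D.label k := fun h k hk => by
    rw [hl']; simp [hk]
  have add3 : ∀ m : ZMod 4, m + 1 + 2 = m + 3 := by decide
  obtain ⟨s1, s2, s3, s4⟩ := hs1
  obtain ⟨s5, s6, s7, s8⟩ := hs2
  obtain ⟨s9, s10, s11, s12⟩ := hs3
  replace s1 := conv _ _ s1
  replace s2 := conv _ _ s2
  replace s3 := conv _ _ s3
  replace s4 := conv _ _ s4
  replace s5 := conv _ _ s5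
  replace s6 := conv _ _ s6
  replace s7 := conv _ _ s7
  replace s8 := conv _ _ s8
  replace s9 := conv _ _ s9
  replace s10 := conv _ _ s10
  replace s11 := conv _ _ s11
  replace s12 := conv _ _ s12
  simp only [opp, add3, ← h1, ← h2, ← h3] at s1 s2 s3 s4 s5 s6 s7 s8 s9 s10 s11 s12
  have hother : ∀ w m, w ≠ x → w ≠ y → w ≠ z → l' (w, m) = D.label (w, m) := fun w m a b c =>
    conv _ _ (hrest' w m a b c)
  have hends1 : ∀ w m, D.label (w, m) = D.label (x, i) → w = x ∧ m = i ∨ w = y ∧ m = j + 1 := by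
    intro w m h
    rcases D.eq_or_eq_of_label_eq h1 (by simp [hxy]) h with h | h <;> simp_all
  have hends2 : ∀ w m, D.label (w, m) = D.label (y, j) → w = y ∧ m = j ∨ w = z ∧ m = k + 1 := by
    intro w m h
    rcases D.eq_or_eq_of_label_eq h2 (by simp [hyz]) h with h | h <;> simp_all
  have hends3 : ∀ w m, D.label (w, m) = D.label (z, k) → w = z ∧ m = k ∨ w = x ∧ m = i + 1 := by
    intro w m h
    rcases D.eq_or_eq_of_label_eq h3 (by simp [hzx]) h with h | h <;> simp_all
  rw [hZ, stateSum_eq, M.partition_eq D.toDiagramCode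
    (fun w => if w = x then i else if w = y then j else k) {x, y, z}]
  have hZ' : ∀ c : D.E → C, ∏ w, weightFrom M.W (fun m => c (l' (w, m))) 0 =
      (∏ w ∈ ({x, y, z} : Finset D.X)ᶜ, weightFrom M.W (fun m => c (D.label (w, m))) 0) *
      ∏ w ∈ ({x, y, z} : Finset D.X), weightFrom M.W (fun m => c (l' (w, m)))
        (if w = x then i else if w = y then j else k) := by
    intro c
    rw [← Finset.prod_compl_mul_prod {x, y, z}]
    congr 1
    · refine Finset.prod_congr rfl fun w hw => ?_
      have hw' : w ≠ x ∧ w ≠ y ∧ w ≠ z := by simpa using hw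
      simp only [hother w _ hw'.1 hw'.2.1 hw'.2.2]
    · exact Finset.prod_congr rfl fun x _ => (weightFrom_eq_zero_end M.rotate _ _).symm
  simp only [hZ']
  refine sum_eq_of_update₃ (D.label (x, i)) (D.label (y, j)) (D.label (z, k)) fun c => ?_
  set e₁ := D.label (x, i) with he₁
  set e₂ := D.label (y, j) with he₂
  set e₃ := D.label (z, k) with he₃
  -- The sides are three different arcs, so their colours can be summed independently.
  have ne12 : e₁ ≠ e₂ := fun h => by
    rcases hends2 _ _ h with h | h
    · exact hxy h.1
    · exact hzx h.1.symm
  have ne13 : e₁ ≠ e₃ := fun h => by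
    rcases hends3 _ _ h with h | h
    · exact hzx h.1.symm
    · exact ne_add_one i h.2
  have ne23 : e₂ ≠ e₃ := fun h => by
    rcases hends3 _ _ h with h | h
    · exact hyz h.1
    · exact hxy h.1.symm
  obtain ⟨K, hK⟩ : ∃ K, K = ∏ w ∈ ({x, y, z} : Finset D.X)ᶜ,
      weightFrom M.W (fun m => c (D.label (w, m))) 0 := ⟨_, rfl⟩
  obtain ⟨u, hu⟩ : ∃ u : C → C → C → D.E → C, ∀ v₁ v₂ v₃, Function.update
      (Function.update (Function.update c e₁ v₁) e₂ v₂) e₃ v₃ = u v₁ v₂ v₃ :=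
    ⟨_, fun _ _ _ => rfl⟩
  have u1 : ∀ v₁ v₂ v₃, u v₁ v₂ v₃ e₁ = v₁ := fun v₁ v₂ v₃ => by
    rw [← hu, Function.update_of_ne ne13, Function.update_of_ne ne12, Function.update_self]
  have u2 : ∀ v₁ v₂ v₃, u v₁ v₂ v₃ e₂ = v₂ := fun v₁ v₂ v₃ => by
    rw [← hu, Function.update_of_ne ne23, Function.update_self]
  have u3 : ∀ v₁ v₂ v₃, u v₁ v₂ v₃ e₃ = v₃ := fun v₁ v₂ v₃ => by
    rw [← hu, Function.update_self]
  have u0 : ∀ v₁ v₂ v₃ w m, ¬ (w = x ∧ m = i ∨ w = y ∧ m = j + 1) →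
      ¬ (w = y ∧ m = j ∨ w = z ∧ m = k + 1) → ¬ (w = z ∧ m = k ∨ w = x ∧ m = i + 1) →
      u v₁ v₂ v₃ (D.label (w, m)) = c (D.label (w, m)) := fun v₁ v₂ v₃ w m n1 n2 n3 => by
    rw [← hu, Function.update_of_ne (mt (hends3 w m) n3), Function.update_of_ne (mt (hends2 w m) n2),
      Function.update_of_ne (mt (hends1 w m) n1)]
  have hrest : ∀ v₁ v₂ v₃, ∏ w ∈ ({x, y, z} : Finset D.X)ᶜ, weightFrom M.W
      (fun m => u v₁ v₂ v₃ (D.label (w, m))) 0 = K := by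
    intro v₁ v₂ v₃
    rw [hK]
    refine Finset.prod_congr rfl fun w hw => ?_
    have hw' : w ≠ x ∧ w ≠ y ∧ w ≠ z := by simpa using hw
    have : ∀ m, u v₁ v₂ v₃ (D.label (w, m)) = c (D.label (w, m)) := fun m =>
      u0 _ _ _ _ _ (by simp [hw']) (by simp [hw']) (by simp [hw'])
    simp only [this]
  have n20 : (2 : ZMod 4) ≠ 0 := by decide
  have n21 : (2 : ZMod 4) ≠ 1 := by decide
  have n30 : (3 : ZMod 4) ≠ 0 := by decide
  have n31 : (3 : ZMod 4) ≠ 1 := by decide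
  have x2 := fun v₁ v₂ v₃ => u0 v₁ v₂ v₃ x (i + 2) (by simp [hxy, n20, n21])
    (by simp [hxy, hzx.symm]) (by simp [n20, n21, hzx.symm])
  have x3 := fun v₁ v₂ v₃ => u0 v₁ v₂ v₃ x (i + 3) (by simp [hxy, n30, n31])
    (by simp [hxy, hzx.symm]) (by simp [n30, n31, hzx.symm])
  have y2 := fun v₁ v₂ v₃ => u0 v₁ v₂ v₃ y (j + 2) (by simp [hxy.symm, n20, n21])
    (by simp [hyz, n20, n21]) (by simp [hyz, hxy.symm])
  have y3 := fun v₁ v₂ v₃ => u0 v₁ v₂ v₃ y (j + 3) (by simp [hxy.symm, n30, n31])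
    (by simp [hyz, n30, n31]) (by simp [hyz, hxy.symm])
  have z2 := fun v₁ v₂ v₃ => u0 v₁ v₂ v₃ z (k + 2) (by simp [hzx, hyz.symm])
    (by simp [hyz.symm, n20, n21]) (by simp [hzx, n20, n21])
  have z3 := fun v₁ v₂ v₃ => u0 v₁ v₂ v₃ z (k + 3) (by simp [hzx, hyz.symm])
    (by simp [hyz.symm, n30, n31]) (by simp [hzx, n30, n31])
  have hprod : ∀ f : D.X → ℝ, ∏ w ∈ ({x, y, z} : Finset D.X), f w = f x * f y * f z := fun f => by
    rw [Finset.prod_insert (by simp [hxy, hzx.symm]), Finset.prod_pair hyz, mul_assoc]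
  simp only [hu, hrest]
  simp only [hprod, if_true, if_neg hxy.symm, if_neg hzx, if_neg hyz.symm, weightFrom,
    ← he₁, ← he₂, ← he₃, ← h1, ← h2, ← h3, s1, s2, s3, s4, s5, s6, s7, s8, s9, s10, s11, s12,
    u1, u2, u3, x2, x3, y2, y3, z2, z3, ← Finset.mul_sum]
  congr 1
  exact M.triangle_of_ne hlev _ _ _ _ _ _

/-- Up to sign, the product of the state sums of the model and the swapped model is an invariant
of links. -/
theorem abs_partition_mul_eq_of_link_eq [Nonempty C] (M : VertexModel C)
    (hκ : |M.κ true * M.κ false| = 1) (hε : |M.ε| = 1) {D D' : LinkDiagram}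
    (h : D.link = D'.link) :
    |M.partition D.toDiagramCode * M.swap.partition D.toDiagramCode| =
      |M.partition D'.toDiagramCode * M.swap.partition D'.toDiagramCode| := by
  have h' := Quot.eqvGen_exact h
  induction h' with
  | refl => rfl
  | symm _ _ _ ih => exact (ih (Quot.eqvGen_sound ‹_›)).symm
  | trans _ _ _ h1 h2 ih ih' =>
    exact (ih (Quot.eqvGen_sound h1)).trans (ih' (Quot.eqvGen_sound h2))
  | rel D D' hs =>
    rcases hs with hs | hs | hs | hs
    · rw [M.partition_iso hs, M.swap.partition_iso hs]
    · obtain ⟨x, i, hi, hE⟩ := hs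
      rw [partition_moveI hi hE M, partition_moveI hi hE M.swap, mul_mul_mul_comm, abs_mul]
      -- Whatever the kind of the kink, one model contributes `κ true` and the other `κ false`.
      have : |M.κ (isLower i) * M.swap.κ (isLower i)| = 1 := by
        rw [← hκ]
        cases isLower i <;> simp [swap, mul_comm]
      rw [this, one_mul]
    · rw [partition_moveII hs M, partition_moveII hs M.swap, mul_mul_mul_comm, abs_mul]
      have : |M.ε * M.swap.ε| = 1 := by
        show |M.ε * M.ε| = 1
        rw [abs_mul, hε, one_mul]
      rw [this, one_mul]
    · rw [partition_moveIII hs M, partition_moveIII hs M.swap]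

end VertexModel

/-! ### The Kauffman bracket with an integral loop value -/

section Smoothing

variable {C : Type} [DecidableEq C]

/-- The weight `α` for joining the ends `0, 1` and `2, 3`, plus the weight `β` for joining `1, 2` and
`3, 0`. -/
noncomputable def smoothingWeight (α β : ℝ) (c₀ c₁ c₂ c₃ : C) : ℝ :=
  α * ((if c₀ = c₁ then 1 else 0) * if c₂ = c₃ then 1 else 0) +
    β * ((if c₁ = c₂ then 1 else 0) * if c₃ = c₀ then 1 else 0)

theorem smoothingWeight_rotate (α β : ℝ) (c₀ c₁ c₂ c₃ : C) :
    smoothingWeight α β c₀ c₁ c₂ c₃ = smoothingWeight β α c₁ c₂ c₃ c₀ := by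
  simp only [smoothingWeight, eq_comm (a := c₀) (b := c₁)]
  ring

variable [Fintype C]

/-- One smoothing splits off a free circle, worth one summand per colour; the other merely
straightens the strand. -/
theorem sum_smoothingWeight_kink (α β : ℝ) (a b : C) :
    ∑ e, smoothingWeight α β e e a b = if a = b then α * Fintype.card C + β else 0 := by
  simp only [smoothingWeight, Finset.sum_add_distrib]
  by_cases hab : a = b
  · subst hab
    simp [mul_comm]
  · simp [hab, Ne.symm hab]

/-- Makes the truth values of equations indeterminates, so that identities between contracted sums
become polynomial identities. -/
theorem exists_indicator : ∃ I : Prop → ℝ, (∀ (p : Prop) [Decidable p] (a : ℝ),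
    (if p then a else 0) = I p * a) := by
  classical
  refine ⟨fun p => if p then 1 else 0, fun p _ a => ?_⟩
  by_cases h : p <;> simp [h]

/-- Of the four smoothings of the bigon one yields the two pulled apart strands. The other three
yield the same turnback, with total coefficient `α ^ 2 + β ^ 2 + card C * α * β`, which vanishes. -/
theorem sum_smoothingWeight_bigon {α β : ℝ} (h : α ^ 2 + β ^ 2 + Fintype.card C * (α * β) = 0)
    (a b a' b' : C) :
    ∑ e, ∑ e', smoothingWeight α β e e' a b * smoothingWeight α β e b' a' e' =
      if a = a' ∧ b = b' then α * β else 0 := by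
  simp only [smoothingWeight, mul_add, add_mul, Finset.sum_add_distrib, ite_and]
  simp [eq_comm (a := b) (b := a), eq_comm (a := b') (b := a'), eq_comm (a := a') (b := a)]
  obtain ⟨I, hI⟩ := exists_indicator
  simp only [hI]
  linear_combination I (a = b) * I (a' = b') * h

/-- Expanded into pairings of the six outer ends, the two sides differ by `α * (α ^ 2 + β ^ 2 + card
C * α * β)` times the difference of the two pairings of neighbouring ends. -/
theorem sum_smoothingWeight_triangle {α β : ℝ} (h : α ^ 2 + β ^ 2 + Fintype.card C * (α * β) = 0)
    (x₂ x₃ y₂ y₃ z₂ z₃ : C) :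
    ∑ e₁ : C, ∑ e₂ : C, ∑ e₃ : C, smoothingWeight α β e₁ e₃ x₂ x₃ *
      smoothingWeight α β e₂ e₁ y₂ y₃ * smoothingWeight β α e₃ e₂ z₂ z₃ =
    ∑ e₁ : C, ∑ e₂ : C, ∑ e₃ : C, smoothingWeight α β y₃ z₂ e₁ e₃ *
      smoothingWeight α β z₃ x₂ e₂ e₁ * smoothingWeight β α x₃ y₂ e₃ e₂ := by
  simp only [smoothingWeight, mul_add, add_mul, Finset.sum_add_distrib]
  simp [mul_comm, mul_assoc, mul_left_comm, Finset.sum_ite_eq]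
  simp only [eq_comm (a := x₃) (b := x₂), eq_comm (a := y₃) (b := y₂), eq_comm (a := z₃) (b := z₂),
    eq_comm (a := z₃) (b := x₂), eq_comm (a := y₃) (b := z₂), eq_comm (a := x₃) (b := y₂),
    eq_comm (a := y₃) (b := x₂), eq_comm (a := z₃) (b := y₂), eq_comm (a := x₃) (b := z₂)]
  obtain ⟨I, hI⟩ := exists_indicator
  simp only [hI]
  linear_combination α * (I (z₂ = z₃) * I (y₂ = y₃) * I (x₂ = x₃)
    - I (x₂ = z₃) * I (z₂ = y₃) * I (y₂ = x₃)) * h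

/-- The Kauffman bracket at `-A ^ 2 - A ^ (-2) = n` for a natural number `n`, up to powers of the
imaginary unit; `A` is `a` times the imaginary unit. -/
noncomputable def bracketModel (C : Type) [Fintype C] [DecidableEq C] (a : ℝ) (ha : a ≠ 0)
    (hC : (Fintype.card C : ℝ) = a ^ 2 + a⁻¹ ^ 2) : VertexModel C where
  W t := bif t then smoothingWeight a (-a⁻¹) else smoothingWeight (-a⁻¹) a
  κ t := bif t then a ^ 3 else -a⁻¹ ^ 3
  ε := -1
  rotate t a b c d := by cases t <;> exact smoothingWeight_rotate _ _ _ _ _ _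
  kink t b b' := by
    cases t <;> simp only [cond_true, cond_false, sum_smoothingWeight_kink] <;> congr 1 <;>
      rw [hC] <;> field_simp <;> ring
  bigon t b c b' c' := by
    cases t <;> simp only [cond_true, cond_false] <;> rw [sum_smoothingWeight_bigon]
    · congr 1; field_simp
    · rw [hC]; field_simp; ring
    · congr 1; field_simp
    · rw [hC]; field_simp; ring
  triangle t x₂ x₃ y₂ y₃ z₂ z₃ := by
    cases t <;> simp only [cond_true, cond_false, Bool.not_true, Bool.not_false] <;>
      refine sum_smoothingWeight_triangle ?_ _ _ _ _ _ _ <;>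
      rw [hC] <;> field_simp <;> ring

end Smoothing

/-! ### The flow model of the Yamada polynomial -/

section Flow

/-- The excluded terms are subtracted once each, whatever coincidences there are among `o`, `p`,
`q`. -/
theorem sum_outside_three {G : Type} [Fintype G] [DecidableEq G] (o p q : G) (f : G → ℝ) :
    (∑ g, if g ≠ o ∧ g ≠ p ∧ g ≠ q then f g else 0) =
      ∑ g, f g - f o - (if o = p then 0 else f p) - (if o = q ∨ p = q then 0 else f q) := by
  have h : ∀ g, (if g ≠ o ∧ g ≠ p ∧ g ≠ q then f g else 0) = f g - (if g = o then f o else 0)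
      - (if g = p then (if o = p then 0 else f p) else 0)
      - (if g = q then (if o = q ∨ p = q then 0 else f q) else 0) := fun g => by
    by_cases h1 : g = o <;> by_cases h2 : g = p <;> by_cases h3 : g = q <;> simp_all [eq_comm]
  simp only [h, Finset.sum_sub_distrib, Finset.sum_ite_eq', Finset.mem_univ, if_true]

theorem sum_faces_corner {G : Type} [Fintype G] [DecidableEq G] (u v w β β' γ : ℝ)
    (r s t : G) :
    (∑ g, (u + β * (if g = r then 1 else 0)) * (v + β' * (if g = s then 1 else 0)) *
      (w + γ * (if g = t then 1 else 0))) = u * v * w * Fintype.card G + β * v * w + u * β' * w +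
      u * v * γ + β * β' * w * (if r = s then 1 else 0) + β * v * γ * (if r = t then 1 else 0) +
      u * β' * γ * (if s = t then 1 else 0) +
      β * β' * γ * (if r = t then 1 else 0) * (if s = t then 1 else 0) := by
  simp only [mul_add, add_mul, Finset.sum_add_distrib]
  simp [mul_comm, mul_assoc, mul_left_comm]
  simp only [eq_comm (a := t) (b := s), eq_comm (a := t) (b := r), eq_comm (a := s) (b := r)]
  obtain ⟨I, hI⟩ := exists_indicator
  simp only [hI]
  ring

-- A flow of exponent two around the triangle is a difference of face colours. The outer faces are
-- `o, r, p, t, q, s` in cyclic order, neighbours being separated by an arc with nonzero colour.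
-- Before the move the inner face `g` borders on `o, p, q` and meets `r, s, t` at its corners; after
-- the move these triples are exchanged.
set_option maxHeartbeats 4000000 in
theorem sum_faces_triangle {G : Type} [Fintype G] [DecidableEq G] {α β : ℝ} (h : α * β = 1)
    (hG : (Fintype.card G : ℝ) = α + β + 2) {o p q r s t : G} (hor : o ≠ r) (hrp : r ≠ p)
    (hpt : p ≠ t) (htq : t ≠ q) (hqs : q ≠ s) (hso : s ≠ o) :
    (∑ g, if g ≠ o ∧ g ≠ p ∧ g ≠ q then
      (-1 + α * (if o = p then 1 else 0) + β * (if g = r then 1 else 0)) *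
      (-1 + α * (if o = q then 1 else 0) + β * (if g = s then 1 else 0)) *
      (-1 + β * (if p = q then 1 else 0) + α * (if g = t then 1 else 0)) else 0) =
    ∑ g, if g ≠ r ∧ g ≠ s ∧ g ≠ t then
      (-1 + α * (if s = t then 1 else 0) + β * (if g = q then 1 else 0)) *
      (-1 + α * (if r = t then 1 else 0) + β * (if g = p then 1 else 0)) *
      (-1 + β * (if r = s then 1 else 0) + α * (if g = o then 1 else 0)) else 0 := by
  have hα : α ≠ 0 := left_ne_zero_of_mul_eq_one h
  obtain rfl : β = α⁻¹ := eq_inv_of_mul_eq_one_right h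
  rw [sum_outside_three, sum_outside_three, sum_faces_corner, sum_faces_corner, hG]
  -- Both sides depend only on which outer faces have equal colours: within each triple, or for the
  -- opposite pairs `q, r`, `p, s`, `o, t`. Each consistent pattern leaves a rational identity in
  -- `α`; the others are contradictory.
  have tri : ∀ a b c : G, ((a = b) = True ∧ (a = c) = True ∧ (b = c) = True) ∨
      ((a = b) = True ∧ (a = c) = False ∧ (b = c) = False) ∨
      ((a = b) = False ∧ (a = c) = True ∧ (b = c) = False) ∨
      ((a = b) = False ∧ (a = c) = False ∧ (b = c) = True) ∨
      ((a = b) = False ∧ (a = c) = False ∧ (b = c) = False) := by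
    intro a b c; grind
  simp only [eq_comm (a := p) (b := o), eq_comm (a := q) (b := o), eq_comm (a := q) (b := p),
    eq_comm (a := t) (b := r),
    eq_comm (a := r) (b := q), eq_comm (a := s) (b := p), eq_comm (a := t) (b := o),
    hor, hrp, hpt, htq, hqs, hso, hor.symm, hrp.symm, hpt.symm, htq.symm, hqs.symm, hso.symm,
    if_false]
  rcases tri o p q with ⟨h1, h2, h3⟩ | ⟨h1, h2, h3⟩ | ⟨h1, h2, h3⟩ | ⟨h1, h2, h3⟩ | ⟨h1, h2, h3⟩ <;>
  rcases tri r s t with ⟨h4, h5, h6⟩ | ⟨h4, h5, h6⟩ | ⟨h4, h5, h6⟩ | ⟨h4, h5, h6⟩ | ⟨h4, h5, h6⟩ <;>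
  rcases Classical.propComplete (q = r) with h7 | h7 <;>
  rcases Classical.propComplete (p = s) with h8 | h8 <;>
  rcases Classical.propComplete (o = t) with h9 | h9 <;>
  simp only [h1, h2, h3, h4, h5, h6, h7, h8, h9, if_true, if_false, or_true, or_false,
    false_or] <;>
  first
  | (field_simp; ring1)
  | (exfalso; clear tri h hG; grind)

end Flow

section FlowModel

/-- In characteristic two `a = b` means `a + b = 0`, so equivalences between equations of colours
reduce to one linear identity. -/
theorem eq_iff_eq_of_add_eq {G : Type} [CommRing G] (two : (2 : G) = 0) {a b c d : G} (h : a + b = c + d) :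
    a = b ↔ c = d := by
  constructor
  · rintro rfl
    linear_combination -h + (a - d) * two
  · rintro rfl
    linear_combination h + (c - b) * two

/-- The weight of a flow with values in a group of exponent two at a crossing: `-1` for the
4-valent vertex, `α` and `β` for the two smoothings. -/
noncomputable def flowWeight {G : Type} [CommRing G] [DecidableEq G] (α β : ℝ) (c₀ c₁ c₂ c₃ : G) :
    ℝ :=
  if c₀ + c₁ + c₂ + c₃ = 0 then
    -1 + α * (if c₀ = c₁ then 1 else 0) + β * (if c₁ = c₂ then 1 else 0) else 0

variable {G : Type} [CommRing G] [DecidableEq G]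

theorem flowWeight_rotate (two : (2 : G) = 0) (α β : ℝ) (a b c d : G) :
    flowWeight α β a b c d = flowWeight β α b c d a := by
  unfold flowWeight
  have h1 : a + b + c + d = 0 ↔ b + c + d + a = 0 := by grind
  simp only [h1]
  split_ifs <;> grind

variable [Fintype G]

theorem sum_nonzero (f : G → ℝ) : ∑ e : {g : G // g ≠ 0}, f e = ∑ g, if g ≠ 0 then f g else 0 := by
  rw [← Finset.sum_filter]
  exact (Finset.sum_subtype _ (by simp) f).symm

/-- Eliminates an arc whose colour is forced by conservation, leaving the condition that this colour
is nonzero. -/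
theorem sum_nonzero_ite_eq (r : G) (f : G → ℝ) :
    (∑ e : {g : G // g ≠ 0}, if (e : G) = r then f e else 0) = if r ≠ 0 then f r else 0 := by
  rw [sum_nonzero fun g => if g = r then f g else 0]
  by_cases hr : r = 0
  · subst hr
    simp only [ne_eq, not_true_eq_false, if_false]
    refine Finset.sum_eq_zero fun g _ => ?_
    by_cases h : g = 0 <;> simp [h]
  · rw [if_pos hr, Finset.sum_eq_single r]
    · simp [hr]
    · intro g _ hg; simp [hg]
    · simp

/-- Conservation forces `a = b`. The loop takes all `α + β + 1` nonzero colours, giving `(α - 1) *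
(α + β + 1) + β`, which is `α ^ 2` because `α * β = 1`. -/
theorem sum_flowWeight_kink (two : (2 : G) = 0) {α β : ℝ} (h : α * β = 1)
    (hG : (Fintype.card G : ℝ) = α + β + 2) (a b : {g : G // g ≠ 0}) :
    ∑ e : {g : G // g ≠ 0}, flowWeight α β (e : G) e a b = if a = b then α ^ 2 else 0 := by
  have key : ∀ e : G, flowWeight α β e e a b =
      if a = b then (-1 + α) + β * (if e = a then 1 else 0) else 0 := fun e => by
    unfold flowWeight
    have h1 : e + e + a + b = 0 ↔ a = b := by
      rw [Subtype.ext_iff]; grind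
    simp [h1]
  rw [sum_nonzero fun e : G => flowWeight α β e e a b]
  simp only [key]
  by_cases hab : a = b
  · have h3 := sum_outside_three (0 : G) 0 0 fun e => (-1 + α) + β * (if e = a then 1 else 0)
    simp only [and_self, true_or, if_true, Finset.sum_add_distrib, ← Finset.mul_sum,
      Finset.sum_ite_eq', Finset.mem_univ, Finset.sum_const, Finset.card_univ, nsmul_eq_mul, hG,
      if_neg a.2.symm] at h3
    simp only [if_pos hab]
    rw [h3]
    linear_combination h
  · simp [hab]

/-- Conservation determines `e' = e + a + b`, so only a sum over `e` outside `0` and `a + b`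
remains; conservation at the second crossing demands `a + b = a' + b'`. -/
theorem sum_flowWeight_bigon (two : (2 : G) = 0) {α β : ℝ} (h : α * β = 1)
    (hG : (Fintype.card G : ℝ) = α + β + 2) (a b a' b' : {g : G // g ≠ 0}) :
    ∑ e : {g : G // g ≠ 0}, ∑ e' : {g : G // g ≠ 0},
      flowWeight α β (e : G) e' a b * flowWeight α β (e : G) b' a' e' =
      if a = a' ∧ b = b' then 1 else 0 := by
  have key : ∀ e e' : G, flowWeight α β e e' a b * flowWeight α β e b' a' e' =
      if e' = e + a + b then (if (a + b : G) = a' + b' then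
        (-1 + α * (if (a : G) = b then 1 else 0) + β * (if e = b then 1 else 0)) *
        (-1 + α * (if e = b' then 1 else 0) + β * (if (a : G) = b then 1 else 0)) else 0)
      else 0 := fun e e' => by
    unfold flowWeight
    have h1 : e + e' + a + b = 0 ↔ e' = e + a + b := by grind
    simp only [h1]
    by_cases h2 : e' = e + a + b
    · subst h2
      have h3 : e + b' + a' + (e + a + b) = 0 ↔ (a + b : G) = a' + b' := by grind
      have h4 : e = e + a + b ↔ (a : G) = b := by grind
      have h5 : e + a + b = a ↔ e = b := by grind
      simp only [h3, h4, h5, if_true]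
      by_cases h6 : (a + b : G) = a' + b'
      · have h7 : (b' : G) = a' ↔ (a : G) = b := by grind
        simp [h6, h7]
      · simp [h6]
    · simp [h2]
  have key' : ∀ e : G, ∑ e' : {g : G // g ≠ 0},
      flowWeight α β e e' a b * flowWeight α β e b' a' e' =
      if e + a + b ≠ 0 then (if (a + b : G) = a' + b' then
        (-1 + α * (if (a : G) = b then 1 else 0) + β * (if e = b then 1 else 0)) *
        (-1 + α * (if e = b' then 1 else 0) + β * (if (a : G) = b then 1 else 0)) else 0)
      else 0 := fun e => by
    simp only [key]
    exact sum_nonzero_ite_eq _ fun _ => _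
  simp only [key']
  rw [sum_nonzero fun e : G => if e + a + b ≠ 0 then (if (a + b : G) = a' + b' then
        (-1 + α * (if (a : G) = b then 1 else 0) + β * (if e = b then 1 else 0)) *
        (-1 + α * (if e = b' then 1 else 0) + β * (if (a : G) = b then 1 else 0)) else 0) else 0]
  by_cases h6 : (a + b : G) = a' + b'
  · have h8 : ∀ e : G, e + a + b ≠ 0 ↔ e ≠ a + b := by grind
    have h3 := sum_outside_three (0 : G) (a + b) (a + b) fun e =>
        (-1 + α * (if (a : G) = b then 1 else 0) + β * (if e = b then 1 else 0)) *
        (-1 + α * (if e = b' then 1 else 0) + β * (if (a : G) = b then 1 else 0))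
    simp only [and_self, ite_and] at h3
    simp only [h6, if_true]
    simp only [h8]
    rw [h3]
    have h9 : (a = a' ∧ b = b') ↔ (b : G) = b' := by
      rw [Subtype.ext_iff, Subtype.ext_iff]; grind
    simp only [h9]
    -- If `a = b`, the two excluded values `0` and `a + b` coincide and only one term is removed.
    by_cases hab : (a : G) = b
    · have h10 : (0 : G) = a + b := by grind
      simp only [hab, if_true, or_true, mul_one, mul_add, add_mul, Finset.sum_add_distrib,
        if_neg b.2.symm, if_neg b'.2.symm]
      simp [hG]
      have h13 : (0 : G) = b + b := by grind
      simp only [if_pos h13, eq_comm (a := (b' : G)) (b := b)]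
      obtain ⟨I, hI⟩ := exists_indicator
      simp only [hI]
      linear_combination (α + β - 1 + I ((b : G) = b')) * h
    · have h10 : (0 : G) ≠ a + b := by grind
      have h11 : (a + b : G) ≠ b := by have := a.2; grind
      have h12 : (a + b : G) ≠ b' := by have := a'.2; grind
      simp only [h10, hab, if_false, or_true, mul_add, add_mul, Finset.sum_add_distrib,
        if_neg b.2.symm, if_neg b'.2.symm, if_neg h11, if_neg h12, if_true]
      simp [hG]
      simp only [eq_comm (a := (b' : G)) (b := b)]
      obtain ⟨I, hI⟩ := exists_indicator
      simp only [hI]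
      linear_combination I ((b : G) = b') * h
  · have h9 : ¬ (a = a' ∧ b = b') := fun hh => h6 (by rw [hh.1, hh.2])
    simp only [if_neg h6, if_neg h9, ite_self, Finset.sum_const_zero]

/-- Conservation at two corners determines `e₃` and `e₂` from `e₁`; at the third it is the vanishing
of the outer sum. With one outer face coloured `0`, the colour of the inner face is `e₁`. -/
theorem sum_flowWeight_triangle_eq (two : (2 : G) = 0) {α β : ℝ}
    (x₂ x₃ y₂ y₃ z₂ z₃ : {g : G // g ≠ 0}) :
    ∑ e₁ : {g : G // g ≠ 0}, ∑ e₂ : {g : G // g ≠ 0}, ∑ e₃ : {g : G // g ≠ 0},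
      flowWeight α β (e₁ : G) e₃ x₂ x₃ * flowWeight α β (e₂ : G) e₁ y₂ y₃ *
        flowWeight β α (e₃ : G) e₂ z₂ z₃ =
    if (x₂ + x₃ + y₂ + y₃ + z₂ + z₃ : G) = 0 then
      ∑ g : G, if g ≠ 0 ∧ g ≠ x₂ + x₃ ∧ g ≠ y₂ + y₃ then
      (-1 + α * (if 0 = (x₂ + x₃ : G) then 1 else 0) + β * (if g = x₃ then 1 else 0)) *
      (-1 + α * (if 0 = (y₂ + y₃ : G) then 1 else 0) + β * (if g = y₂ then 1 else 0)) *
      (-1 + β * (if (x₂ + x₃ : G) = y₂ + y₃ then 1 else 0) +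
        α * (if g = y₂ + y₃ + z₂ then 1 else 0)) else 0
    else 0 := by
  obtain ⟨T, hT⟩ : ∃ T : G → ℝ, ∀ g, T g =
      (-1 + α * (if 0 = (x₂ + x₃ : G) then 1 else 0) + β * (if g = x₃ then 1 else 0)) *
      (-1 + α * (if 0 = (y₂ + y₃ : G) then 1 else 0) + β * (if g = y₂ then 1 else 0)) *
      (-1 + β * (if (x₂ + x₃ : G) = y₂ + y₃ then 1 else 0) +
        α * (if g = y₂ + y₃ + z₂ then 1 else 0)) := ⟨_, fun _ => rfl⟩
  have key : ∀ e₁ e₂ e₃ : G, flowWeight α β e₁ e₃ x₂ x₃ * flowWeight α β e₂ e₁ y₂ y₃ *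
        flowWeight β α e₃ e₂ z₂ z₃ = if e₃ = e₁ + x₂ + x₃ then (if e₂ = e₁ + y₂ + y₃ then
          (if (x₂ + x₃ + y₂ + y₃ + z₂ + z₃ : G) = 0 then T e₁ else 0) else 0) else 0 := by
    intro e₁ e₂ e₃
    unfold flowWeight
    have h1 : e₁ + e₃ + x₂ + x₃ = 0 ↔ e₃ = e₁ + x₂ + x₃ :=
      eq_iff_eq_of_add_eq two (by linear_combination (0 : G) * two)
    have h2 : e₂ + e₁ + y₂ + y₃ = 0 ↔ e₂ = e₁ + y₂ + y₃ :=
      eq_iff_eq_of_add_eq two (by linear_combination (0 : G) * two)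
    simp only [h1, h2]
    by_cases h3 : e₃ = e₁ + x₂ + x₃
    · by_cases h4 : e₂ = e₁ + y₂ + y₃
      · subst h3 h4
        have h5 : e₁ + x₂ + x₃ + (e₁ + y₂ + y₃) + z₂ + z₃ = 0 ↔
          (x₂ + x₃ + y₂ + y₃ + z₂ + z₃ : G) = 0 :=
          eq_iff_eq_of_add_eq two (by linear_combination e₁ * two)
        have h6 : e₁ = e₁ + x₂ + x₃ ↔ 0 = (x₂ + x₃ : G) :=
          eq_iff_eq_of_add_eq two (by linear_combination e₁ * two)
        have h7 : e₁ + x₂ + x₃ = x₂ ↔ e₁ = x₃ :=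
          eq_iff_eq_of_add_eq two (by linear_combination (x₂ : G) * two)
        have h8 : e₁ + y₂ + y₃ = e₁ ↔ 0 = (y₂ + y₃ : G) :=
          eq_iff_eq_of_add_eq two (by linear_combination e₁ * two)
        have h9 : e₁ + x₂ + x₃ = e₁ + y₂ + y₃ ↔ (x₂ + x₃ : G) = y₂ + y₃ :=
          eq_iff_eq_of_add_eq two (by linear_combination e₁ * two)
        have h10 : e₁ + y₂ + y₃ = z₂ ↔ e₁ = y₂ + y₃ + z₂ :=
          eq_iff_eq_of_add_eq two (by linear_combination (0 : G) * two)
        simp only [h5, h6, h7, h8, h9, h10, if_true, hT, mul_ite, mul_zero]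
      · simp [h4]
    · simp [h3]
  have key₃ : ∀ e₁ e₂ : G, ∑ e₃ : {g : G // g ≠ 0}, flowWeight α β e₁ e₃ x₂ x₃ *
        flowWeight α β e₂ e₁ y₂ y₃ * flowWeight β α (e₃ : G) e₂ z₂ z₃ =
      if e₂ = e₁ + y₂ + y₃ then (if e₁ + x₂ + x₃ ≠ 0 then
          (if (x₂ + x₃ + y₂ + y₃ + z₂ + z₃ : G) = 0 then T e₁ else 0) else 0) else 0 := by
    intro e₁ e₂
    simp only [key]
    rw [sum_nonzero_ite_eq (e₁ + x₂ + x₃) fun _ => _]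
    split_ifs <;> rfl
  have key₂ : ∀ e₁ : G, ∑ e₂ : {g : G // g ≠ 0}, ∑ e₃ : {g : G // g ≠ 0},
        flowWeight α β e₁ e₃ x₂ x₃ *
        flowWeight α β (e₂ : G) e₁ y₂ y₃ * flowWeight β α (e₃ : G) e₂ z₂ z₃ =
      if e₁ + y₂ + y₃ ≠ 0 then (if e₁ + x₂ + x₃ ≠ 0 then
          (if (x₂ + x₃ + y₂ + y₃ + z₂ + z₃ : G) = 0 then T e₁ else 0) else 0) else 0 := by
    intro e₁
    simp only [key₃]
    rw [sum_nonzero_ite_eq (e₁ + y₂ + y₃) fun _ => _]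
  simp only [key₂, ← hT]
  rw [sum_nonzero fun e₁ : G => if e₁ + y₂ + y₃ ≠ 0 then (if e₁ + x₂ + x₃ ≠ 0 then
          (if (x₂ + x₃ + y₂ + y₃ + z₂ + z₃ : G) = 0 then T e₁ else 0) else 0) else 0]
  by_cases h0 : (x₂ + x₃ + y₂ + y₃ + z₂ + z₃ : G) = 0
  · simp only [if_pos h0]
    refine Finset.sum_congr rfl fun g _ => ?_
    have h1 : g + x₂ + x₃ ≠ 0 ↔ g ≠ x₂ + x₃ :=
      not_congr (eq_iff_eq_of_add_eq two (by linear_combination (0 : G) * two))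
    have h2 : g + y₂ + y₃ ≠ 0 ↔ g ≠ y₂ + y₃ :=
      not_congr (eq_iff_eq_of_add_eq two (by linear_combination (0 : G) * two))
    simp only [h1, h2]
    rw [← ite_and, ← ite_and]
    exact if_congr (by tauto) rfl rfl
  · simp only [if_neg h0, ite_self, Finset.sum_const_zero]

theorem sum_flowWeight_triangle (two : (2 : G) = 0) {α β : ℝ} (h : α * β = 1)
    (hG : (Fintype.card G : ℝ) = α + β + 2) (x₂ x₃ y₂ y₃ z₂ z₃ : {g : G // g ≠ 0}) :
    ∑ e₁ : {g : G // g ≠ 0}, ∑ e₂ : {g : G // g ≠ 0}, ∑ e₃ : {g : G // g ≠ 0},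
      flowWeight α β (e₁ : G) e₃ x₂ x₃ * flowWeight α β (e₂ : G) e₁ y₂ y₃ *
        flowWeight β α (e₃ : G) e₂ z₂ z₃ =
    ∑ e₁ : {g : G // g ≠ 0}, ∑ e₂ : {g : G // g ≠ 0}, ∑ e₃ : {g : G // g ≠ 0},
      flowWeight α β (y₃ : G) z₂ e₁ e₃ * flowWeight α β (z₃ : G) x₂ e₂ e₁ *
        flowWeight β α (x₃ : G) y₂ e₃ e₂ := by
  have rot : ∀ α β : ℝ, ∀ a b c d : G, flowWeight α β a b c d = flowWeight α β c d a b :=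
    fun α β a b c d => by rw [flowWeight_rotate two, flowWeight_rotate two]
  have hR : ∀ e₁ e₂ e₃ : G, flowWeight α β (y₃ : G) z₂ e₁ e₃ * flowWeight α β (z₃ : G) x₂ e₂ e₁ *
        flowWeight β α (x₃ : G) y₂ e₃ e₂ = flowWeight α β e₁ e₃ y₃ z₂ *
        flowWeight α β e₂ e₁ z₃ x₂ * flowWeight β α e₃ e₂ x₃ y₂ := fun e₁ e₂ e₃ => by
    rw [rot α β e₁, rot α β e₂, rot β α e₃]
  simp only [hR]
  rw [sum_flowWeight_triangle_eq two, sum_flowWeight_triangle_eq two]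
  have h0 : (x₂ + x₃ + y₂ + y₃ + z₂ + z₃ : G) = 0 ↔ (y₃ + z₂ + z₃ + x₂ + x₃ + y₂ : G) = 0 := by
    rw [show (x₂ + x₃ + y₂ + y₃ + z₂ + z₃ : G) = y₃ + z₂ + z₃ + x₂ + x₃ + y₂ by ring]
  simp only [h0]
  by_cases hs : (y₃ + z₂ + z₃ + x₂ + x₃ + y₂ : G) = 0
  · rw [if_pos hs, if_pos hs]
    -- Two neighbouring outer faces differ by the nonzero colour of the arc between them.
    have ne : ∀ {a b : G} (c : {g : G // g ≠ 0}), a + b = c + 0 → a ≠ b := fun c h =>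
      (not_congr (eq_iff_eq_of_add_eq two h)).mpr c.2
    rw [sum_faces_triangle (o := (0 : G)) (p := x₂ + x₃) (q := y₂ + y₃) (r := x₃) (s := y₂)
      (t := y₂ + y₃ + z₂) h hG
      (ne x₃ (by ring)) (ne x₂ (by linear_combination (x₃ : G) * two))
      (ne z₃ (by linear_combination hs - (z₃ : G) * two))
      (ne z₂ (by linear_combination (y₂ + y₃ : G) * two))
      (ne y₃ (by linear_combination (y₂ : G) * two)) (ne y₂ (by ring))]
    -- The moved triangle assigns `0` to the face called `t` here, so all face colours are
    -- translated by `y₂ + y₃ + z₂`.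
    refine Fintype.sum_equiv (Equiv.addRight (y₂ + y₃ + z₂ : G)) _ _ fun g => ?_
    simp only [Equiv.coe_addRight]
    have h1 : g + (y₂ + y₃ + z₂) ≠ 0 ↔ g ≠ y₂ + y₃ + z₂ :=
      not_congr (eq_iff_eq_of_add_eq two (by linear_combination (0 : G) * two))
    have h2 : g + (y₂ + y₃ + z₂) ≠ y₃ + z₂ ↔ g ≠ y₂ :=
      not_congr (eq_iff_eq_of_add_eq two (by linear_combination (y₃ + z₂ : G) * two))
    have h3 : g + (y₂ + y₃ + z₂) ≠ z₃ + x₂ ↔ g ≠ x₃ :=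
      not_congr (eq_iff_eq_of_add_eq two (by linear_combination hs - (x₃ : G) * two))
    have h4 : (y₂ : G) = y₂ + y₃ + z₂ ↔ 0 = (y₃ + z₂ : G) :=
      eq_iff_eq_of_add_eq two (by linear_combination (y₂ : G) * two)
    have h5 : (x₃ : G) = y₂ + y₃ + z₂ ↔ 0 = (z₃ + x₂ : G) :=
      eq_iff_eq_of_add_eq two (by linear_combination hs - (z₃ + x₂ : G) * two)
    have h6 : (x₃ : G) = y₂ ↔ (y₃ + z₂ : G) = z₃ + x₂ :=
      eq_iff_eq_of_add_eq two (by linear_combination hs - (y₃ + z₂ + z₃ + x₂ : G) * two)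
    have h7 : g + (y₂ + y₃ + z₂) = z₂ ↔ g = y₂ + y₃ :=
      eq_iff_eq_of_add_eq two (by linear_combination (z₂ : G) * two)
    have h8 : g + (y₂ + y₃ + z₂) = z₃ ↔ g = x₂ + x₃ :=
      eq_iff_eq_of_add_eq two (by linear_combination hs - (x₂ + x₃ : G) * two)
    have h9 : g + (y₂ + y₃ + z₂) = z₃ + x₂ + x₃ ↔ g = 0 :=
      eq_iff_eq_of_add_eq two (by linear_combination hs)
    have h10 : (g ≠ x₃ ∧ g ≠ y₂ ∧ g ≠ y₂ + y₃ + z₂) ↔ (g ≠ y₂ + y₃ + z₂ ∧ g ≠ y₂ ∧ g ≠ x₃) :=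
      ⟨fun h => ⟨h.2.2, h.2.1, h.1⟩, fun h => ⟨h.2.2, h.2.1, h.1⟩⟩
    simp only [h1, h2, h3, h4, h5, h6, h7, h8, h9, h10]
  · rw [if_neg hs, if_neg hs]

/-- The specialisation of the Yamada polynomial that counts nowhere zero flows with values in a
group of exponent two. -/
noncomputable def flowModel (G : Type) [CommRing G] [Fintype G] [DecidableEq G]
    (two : (2 : G) = 0) (q : ℝ) (hq : q ≠ 0) (hG : (Fintype.card G : ℝ) = q + q⁻¹ + 2) :
    VertexModel {g : G // g ≠ 0} where
  W t a b c d := bif t then flowWeight q q⁻¹ (a : G) b c d else flowWeight q⁻¹ q (a : G) b c d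
  κ t := bif t then q ^ 2 else q⁻¹ ^ 2
  ε := 1
  rotate t a b c d := by cases t <;> exact flowWeight_rotate two _ _ _ _ _ _
  kink t b b' := by
    cases t
    · exact sum_flowWeight_kink two (inv_mul_cancel₀ hq) (by rw [hG]; ring) _ _
    · exact sum_flowWeight_kink two (mul_inv_cancel₀ hq) hG _ _
  bigon t b c b' c' := by
    cases t
    · exact sum_flowWeight_bigon two (inv_mul_cancel₀ hq) (by rw [hG]; ring) _ _ _ _
    · exact sum_flowWeight_bigon two (mul_inv_cancel₀ hq) hG _ _ _ _
  triangle t x₂ x₃ y₂ y₃ z₂ z₃ := by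
    cases t
    · exact sum_flowWeight_triangle two (inv_mul_cancel₀ hq) (by rw [hG]; ring) _ _ _ _ _ _
    · exact sum_flowWeight_triangle two (mul_inv_cancel₀ hq) hG _ _ _ _ _ _

end FlowModel


/-! ### State circles and colourings -/

/-- The other splice. -/
def Splice.other : Splice → Splice
  | .A => .B
  | .B => .A

namespace DiagramCode

/-- Arcs that are joined by a splice of type `t`. -/
def SpliceRel (D : DiagramCode) (t : Splice) (a b : D.E) : Prop :=
  ∃ x i, D.label (x, i) = a ∧ D.label (x, t.partner i) = b

/-- The state circles of the state with only splices of type `t`. -/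
def Circles (D : DiagramCode) (t : Splice) : Type := Quot (D.SpliceRel t)

theorem finite_circles (D : DiagramCode) (t : Splice) : Finite (D.Circles t) := by
  have := D.finE
  exact Finite.of_surjective (Quot.mk _ : D.E → D.Circles t) Quot.mk_surjective

/-- At every crossing the two pieces of state circles belong to different circles. -/
def SeparatesAt (D : DiagramCode) (t : Splice) : Prop :=
  ∀ x, (Quot.mk _ (D.label (x, 0)) : D.Circles t) ≠ Quot.mk _ (D.label (x, 2))

end DiagramCode

namespace Splice

variable {C : Type}

/-- The colours at the ends that are joined by the splice agree. -/
def Fits (t : Splice) (f : ZMod 4 → C) : Prop := ∀ i, f i = f (t.partner i)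

theorem fits_A (f : ZMod 4 → C) : Splice.A.Fits f ↔ f 0 = f 1 ∧ f 2 = f 3 := by
  constructor
  · exact fun h => ⟨h 0, h 2⟩
  · rintro ⟨h1, h2⟩ i
    have hi : ∀ i : ZMod 4, i = 0 ∨ i = 1 ∨ i = 2 ∨ i = 3 := by decide
    rcases hi i with rfl | rfl | rfl | rfl
    · exact h1
    · exact h1.symm
    · exact h2
    · exact h2.symm

theorem fits_B (f : ZMod 4 → C) : Splice.B.Fits f ↔ f 1 = f 2 ∧ f 3 = f 0 := by
  constructor
  · exact fun h => ⟨h 1, h 3⟩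
  · rintro ⟨h1, h2⟩ i
    have hi : ∀ i : ZMod 4, i = 0 ∨ i = 1 ∨ i = 2 ∨ i = 3 := by decide
    rcases hi i with rfl | rfl | rfl | rfl
    · exact h2.symm
    · exact h1
    · exact h1.symm
    · exact h2

/-- The sum of the colours at a crossing vanishes. -/
def Conserved [AddCommGroup C] (f : ZMod 4 → C) : Prop := f 0 + f 1 + f 2 + f 3 = 0

theorem Fits.conserved [AddCommGroup C] (two : ∀ g : C, g + g = 0) {t : Splice} {f : ZMod 4 → C}
    (h : t.Fits f) : Conserved f := by
  cases t
  · rw [fits_A] at h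
    rw [Conserved, h.1, h.2, two, zero_add, two]
  · rw [fits_B] at h
    rw [Conserved, h.1, h.2, add_assoc (f 0), two, add_zero, two]

/-- Among conserved colours, fitting a splice is a single further equation: one joined pair cancels,
hence so does the other. -/
theorem Conserved.fits [AddCommGroup C] (two : ∀ g : C, g + g = 0) {t : Splice} {f : ZMod 4 → C}
    (h : Conserved f) (h' : f 0 + f (t.partner 0) = 0) : t.Fits f := by
  have eq : ∀ a b : C, a + b = 0 → a = b := fun a b hab => by
    rw [← add_left_inj b, hab, two]
  cases t
  · have h1 : f 0 = f 1 := eq _ _ h'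
    rw [fits_A]
    refine ⟨h1, eq _ _ ?_⟩
    rw [Conserved, h1, two, zero_add] at h
    exact h
  · have h1 : f 0 = f 3 := eq _ _ h'
    rw [fits_B]
    refine ⟨eq _ _ ?_, h1.symm⟩
    have : f 1 + f 2 + (f 0 + f 3) = 0 := by rw [← h]; abel
    rwa [h1, two, add_zero] at this

end Splice

namespace DiagramCode

open Splice

/-! ### Counting colourings with the help of adequacy -/

section Colorings

variable (D : DiagramCode) {C : Type}

/-- The colours at a crossing. -/
def colorsAt (c : D.E → C) (x : D.X) : ZMod 4 → C := fun i => c (D.label (x, i))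

theorem card_fitting_colorings [Fintype C] (t : Splice) :
    Nat.card {c : D.E → C // ∀ x, t.Fits (D.colorsAt c x)} =
      Fintype.card C ^ Nat.card (D.Circles t) := by
  have := D.finite_circles t
  rw [← Nat.card_eq_fintype_card, ← Nat.card_fun]
  refine Nat.card_congr
    { toFun := fun c => Quot.lift c.1 ?_
      invFun := fun c => ⟨fun e => c (Quot.mk _ e), fun x i => ?_⟩
      left_inv := fun c => rfl
      right_inv := fun c => ?_ }
  · rintro a b ⟨x, i, rfl, rfl⟩
    exact c.2 x i
  · exact congrArg c (Quot.sound ⟨x, i, rfl, rfl⟩)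
  · funext e
    induction e using Quot.ind
    rfl

variable [AddCommGroup C]

/-- Colourings that fit the splice `t` outside `S` and are conserved in `S`. -/
def IsColoring (t : Splice) (S : Finset D.X) (c : D.E → C) : Prop :=
  (∀ x ∉ S, t.Fits (D.colorsAt c x)) ∧ ∀ x ∈ S, Conserved (D.colorsAt c x)

/-- The two ends of each arc cancel. -/
theorem sum_ends_eq_zero [Fintype D.X] (two : ∀ g : C, g + g = 0) (f : D.E → C) :
    ∑ h : D.X × ZMod 4, f (D.label h) = 0 :=
  Finset.sum_involution (fun h _ => D.otherEnd h)
    (fun h _ => by rw [D.label_otherEnd]; exact two _) (fun h _ _ => D.otherEnd_ne h)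
    (fun _ _ => Finset.mem_univ _) (fun h _ => D.otherEnd_involutive h)

/-- Sum the colours of all ends on the state circle through `(x₀, 0)`. The total vanishes arc by
arc, and every other crossing contributes zero because the splice fits there. By `SeparatesAt` only
one joined pair at `x₀` lies on this circle, so its two colours cancel and the splice fits at `x₀`
too. -/
theorem isColoring_empty_of_singleton (two : ∀ g : C, g + g = 0) {t : Splice}
    (hD : D.SeparatesAt t) {x₀ : D.X} {c : D.E → C} (hc : D.IsColoring t {x₀} c) :
    D.IsColoring t ∅ c := by
  classical
  have := D.finX
  let _ := Fintype.ofFinite D.X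
  refine ⟨fun x _ => ?_, by simp⟩
  by_cases hx : x = x₀
  swap
  · exact hc.1 x (by simpa using hx)
  subst hx
  have hbal := hc.2 x (by simp)
  refine hbal.fits two ?_
  let q : D.E → D.Circles t := Quot.mk _
  have hq : ∀ y i, q (D.label (y, t.partner i)) = q (D.label (y, i)) := fun y i =>
    (Quot.sound ⟨y, i, rfl, rfl⟩).symm
  -- The colouring cut down to the circle through `(x, 0)`.
  let f : D.E → C := fun e => if q e = q (D.label (x, 0)) then c e else 0
  have hsum := D.sum_ends_eq_zero two f
  rw [Fintype.sum_prod_type, Finset.sum_eq_single x] at hsum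
  · have h4 : ∑ i : ZMod 4, f (D.label (x, i)) = f (D.label (x, 0)) + f (D.label (x, 1)) +
        f (D.label (x, 2)) + f (D.label (x, 3)) := Fin.sum_univ_four _
    have f2 : f (D.label (x, 2)) = 0 := if_neg (hD x).symm
    have f3 : f (D.label (x, t.partner 2)) = 0 := if_neg (by rw [hq]; exact (hD x).symm)
    have f0 : f (D.label (x, 0)) = c (D.label (x, 0)) := if_pos rfl
    have f1 : f (D.label (x, t.partner 0)) = c (D.label (x, t.partner 0)) := if_pos (hq x 0)
    show c (D.label (x, 0)) + c (D.label (x, t.partner 0)) = 0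
    rw [← f0, ← f1]
    rw [h4, f2] at hsum
    cases t
    · have f3 : f (D.label (x, 3)) = 0 := f3
      rw [f3, add_zero, add_zero] at hsum
      exact hsum
    · have f3 : f (D.label (x, 1)) = 0 := f3
      rw [f3, add_zero, add_zero] at hsum
      exact hsum
  · intro y _ hy
    have hfit : t.Fits (fun i => f (D.label (y, i))) := fun i => by
      have h1 := hc.1 y (by simpa using hy) i
      simp only [colorsAt] at h1
      simp only [f, hq, h1]
    exact (Fin.sum_univ_four _).trans (hfit.conserved two)
  · simp

/-- The sum over one joined pair at `x` takes at most `card C` values. Subtracting a fixed colouring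
with the same value injects each fibre into the colourings for `S`. -/
theorem card_isColoring_insert_le [Fintype C] (two : ∀ g : C, g + g = 0) {t : Splice}
    {S : Finset D.X} [DecidableEq D.X] {x : D.X} (hx : x ∉ S) :
    Nat.card {c : D.E → C // D.IsColoring t (insert x S) c} ≤
      Fintype.card C * Nat.card {c : D.E → C // D.IsColoring t S c} := by
  classical
  have := D.finE
  let _ := Fintype.ofFinite D.E
  rw [Nat.card_eq_fintype_card, Nat.card_eq_fintype_card]
  let φ : {c : D.E → C // D.IsColoring t (insert x S) c} → C := fun c =>
    c.1 (D.label (x, 0)) + c.1 (D.label (x, t.partner 0))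
  rw [← Finset.card_univ, mul_comm, ← Finset.card_univ (α := C)]
  refine Finset.card_le_mul_card_image_of_maps_to (f := φ) (fun _ _ => Finset.mem_univ _) _
    fun g _ => ?_
  rcases Finset.eq_empty_or_nonempty (Finset.univ.filter fun c => φ c = g) with h | ⟨c₀, hc₀⟩
  · rw [h]; simp
  rw [← Finset.card_univ]
  have hc₀' : φ c₀ = g := by simpa using hc₀
  have hfits : ∀ {f f' : ZMod 4 → C}, t.Fits f → t.Fits f' → t.Fits (fun i => f i - f' i) :=
    fun h h' i => by simp only [← h i, ← h' i]
  have hbal : ∀ {f f' : ZMod 4 → C}, Conserved f → Conserved f' → Conserved (fun i => f i - f' i) :=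
    fun {f f'} h h' => by
      have : f 0 - f' 0 + (f 1 - f' 1) + (f 2 - f' 2) + (f 3 - f' 3) =
        (f 0 + f 1 + f 2 + f 3) - (f' 0 + f' 1 + f' 2 + f' 3) := by abel
      unfold Conserved at *
      rw [this, h, h', sub_zero]
  have hmem : ∀ c : {c : D.E → C // D.IsColoring t (insert x S) c}, φ c = g →
      D.IsColoring t S (fun e => c.1 e - c₀.1 e) := fun c hc => by
    refine ⟨fun y hy => ?_, fun y hy => ?_⟩
    · by_cases hyx : y = x
      · subst hyx
        refine (hbal (c.2.2 y (by simp)) (c₀.2.2 y (by simp))).fits two ?_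
        have : c.1 (D.label (y, 0)) - c₀.1 (D.label (y, 0)) + (c.1 (D.label (y, t.partner 0)) -
          c₀.1 (D.label (y, t.partner 0))) = φ c - φ c₀ := by simp only [φ]; abel
        simp only [colorsAt]
        rw [this, hc, hc₀', sub_self]
      · exact hfits (c.2.1 y (by simp [hyx, hy])) (c₀.2.1 y (by simp [hyx, hy]))
    · exact hbal (c.2.2 y (by simp [hy])) (c₀.2.2 y (by simp [hy]))
  refine Finset.card_le_card_of_injOn
    -- The zero colouring is only a default outside the fibre.
    (fun c => if h : φ c = g then ⟨_, hmem c h⟩ else ⟨fun _ => 0, ?_⟩) (fun _ _ => Finset.mem_univ _) ?_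
  · exact ⟨fun y _ i => rfl, fun y _ => by simp [Conserved, colorsAt]⟩
  · intro c hc c' hc' h
    have hc : φ c = g := by simpa using hc
    have hc' : φ c' = g := by simpa using hc'
    simp only [hc, hc', dif_pos] at h
    apply Subtype.ext
    funext e
    have := congrFun (congrArg Subtype.val h) e
    exact sub_left_inj.mp this

/-- The first crossing of `S` gives no new colourings and each later one at most a factor `card C`;
the factor on the left records this saving. -/
theorem card_isColoring_le [Fintype C] (two : ∀ g : C, g + g = 0) {t : Splice}
    (hD : D.SeparatesAt t) (S : Finset D.X) (hS : S.Nonempty) :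
    Nat.card {c : D.E → C // D.IsColoring t S c} * Fintype.card C ≤
      Fintype.card C ^ (S.card + Nat.card (D.Circles t)) := by
  classical
  have := D.finE
  induction hS using Finset.Nonempty.cons_induction with
  | singleton x =>
    rw [Finset.card_singleton, pow_add, pow_one, mul_comm, ← D.card_fitting_colorings t]
    refine Nat.mul_le_mul_left _ (Nat.card_le_card_of_injective
      (fun c => ⟨c.1, fun x => (D.isColoring_empty_of_singleton two hD c.2).1 x (by simp)⟩) ?_)
    intro c c' h
    exact Subtype.ext (Subtype.mk.inj h)
  | cons x S hx hS ih =>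
    rw [Finset.cons_eq_insert, Finset.card_insert_of_notMem hx, add_right_comm, pow_succ, mul_comm _ (Fintype.card C), mul_comm _ (Fintype.card C)]
    refine Nat.mul_le_mul_left _ ((D.card_isColoring_insert_le two hx).trans ?_)
    rwa [mul_comm]

end Colorings

end DiagramCode


/-! ### The leading term of a state sum -/

namespace Splice

variable {G : Type} [AddCommGroup G]

/-- The condition on the colours at a crossing with a given marker: `some true` for the splice `t`,
`some false` for the other splice, `none` for a 4-valent vertex. -/
def Allows (t : Splice) : Option Bool → (ZMod 4 → G) → Prop
  | none, f => Conserved f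
  | some true, f => t.Fits f
  | some false, f => t.other.Fits f

end Splice

namespace VertexModel

open VertexSum Splice

variable {C G : Type} [Fintype C] [DecidableEq C] [AddCommGroup G]

-- Expanding the product over the crossings turns the state sum into a sum over markers, each
-- weighted with its number of admissible colourings.
open Classical in
theorem partition_eq_sum_markers (M : VertexModel C) (D : DiagramCode) [Fintype D.X] (t : Splice)
    (ι : C → G) (w : Option Bool → ℝ)
    (hW : ∀ f : ZMod 4 → C, weightFrom M.W f 0 = ∑ m, w m * if t.Allows m (ι ∘ f) then 1 else 0) :
    M.partition D = ∑ s : D.X → Option Bool, (∏ x, w (s x)) *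
      (Nat.card {c : D.E → C // ∀ x, t.Allows (s x) (D.colorsAt (ι ∘ c) x)} : ℝ) := by
  have := D.finX
  have := D.finE
  let _ := Fintype.ofFinite D.E
  have h1 : ∀ c : D.E → C, ∏ x, weightFrom M.W (fun i => c (D.label (x, i))) 0 =
      ∑ s : D.X → Option Bool, (∏ x, w (s x)) *
        if ∀ x, t.Allows (s x) (D.colorsAt (ι ∘ c) x) then 1 else 0 := fun c => by
    simp only [hW]
    rw [Finset.prod_univ_sum, Fintype.piFinset_univ]
    refine Finset.sum_congr rfl fun s _ => ?_
    rw [Finset.prod_mul_distrib]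
    congr 1
    rw [Finset.prod_boole]
    simp only [Finset.mem_univ, true_imp_iff]
    rfl
  rw [partition, stateSum_eq]
  simp only [h1]
  rw [Finset.sum_comm]
  refine Finset.sum_congr rfl fun s _ => ?_
  rw [← Finset.mul_sum, Finset.sum_boole, Nat.card_eq_fintype_card, Fintype.card_subtype]

variable [Fintype G]

/-- With `S` the crossings not marked `some true`, the weights contribute at most `μ ^ S.card` and
the colourings at most `card G ^ S.card`, less one factor. Since `μ * card G ≤ 4 * w (some true)`,
passing to another marker costs at most a factor `4`; the factor `3` per crossing counts the
markers. -/
theorem abs_partition_sub_le (M : VertexModel C) (D : DiagramCode) [Fintype D.X] {t : Splice}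
    (hD : D.SeparatesAt t) (two : ∀ g : G, g + g = 0) {ι : C → G} (hι : Function.Injective ι)
    (w : Option Bool → ℝ)
    (hW : ∀ f : ZMod 4 → C, weightFrom M.W f 0 =
      ∑ m, w m * open Classical in if t.Allows m (ι ∘ f) then 1 else 0)
    (hpos : 0 < w (some true)) {μ : ℝ} (hμ : ∀ m ≠ some true, |w m| ≤ μ)
    (hμw : μ * Fintype.card G ≤ 4 * w (some true)) :
    |M.partition D - w (some true) ^ Fintype.card D.X *
        (Fintype.card C : ℝ) ^ Nat.card (D.Circles t)| ≤
      3 ^ Fintype.card D.X * (4 ^ Fintype.card D.X * w (some true) ^ Fintype.card D.X *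
        (Fintype.card G : ℝ) ^ Nat.card (D.Circles t) / Fintype.card G) := by
  classical
  have := D.finE
  obtain ⟨lam, hlam⟩ : ∃ lam, lam = w (some true) := ⟨_, rfl⟩
  obtain ⟨n, hn⟩ : ∃ n : ℝ, n = Fintype.card G := ⟨_, rfl⟩
  have hn0 : 0 < n := by rw [hn]; exact_mod_cast Fintype.card_pos
  have hμ0 : 0 ≤ μ := (abs_nonneg _).trans (hμ none (by simp))
  rw [← hlam] at hpos hμw ⊢
  rw [← hn] at hμw ⊢
  let s₀ : D.X → Option Bool := fun _ => some true
  have hmain : (∏ x, w (s₀ x)) *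
      (Nat.card {c : D.E → C // ∀ x, t.Allows (s₀ x) (D.colorsAt (ι ∘ c) x)} : ℝ) =
      lam ^ Fintype.card D.X * (Fintype.card C : ℝ) ^ Nat.card (D.Circles t) := by
    have h1 : Nat.card {c : D.E → C // ∀ x, t.Allows (s₀ x) (D.colorsAt (ι ∘ c) x)} =
        Nat.card {c : D.E → C // ∀ x, t.Fits (D.colorsAt c x)} := by
      refine Nat.card_congr (Equiv.subtypeEquivRight fun c => forall_congr' fun x => ?_)
      exact forall_congr' fun i => hι.eq_iff
    rw [h1, D.card_fitting_colorings]
    simp [s₀, hlam]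
  have hterm : ∀ s : D.X → Option Bool, s ≠ s₀ → |(∏ x, w (s x)) *
      (Nat.card {c : D.E → C // ∀ x, t.Allows (s x) (D.colorsAt (ι ∘ c) x)} : ℝ)| ≤
      4 ^ Fintype.card D.X * lam ^ Fintype.card D.X * n ^ Nat.card (D.Circles t) / n := by
    intro s hs
    let S : Finset D.X := Finset.univ.filter fun x => s x ≠ some true
    have hS : S.Nonempty := by
      obtain ⟨x, hx⟩ := Function.ne_iff.mp hs
      exact ⟨x, by simpa [S, s₀] using hx⟩
    -- Fitting either splice implies conservation, so all markers in `S` may be relaxed to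
    -- conservation.
    have hcard : Nat.card {c : D.E → C // ∀ x, t.Allows (s x) (D.colorsAt (ι ∘ c) x)} ≤
        Nat.card {c : D.E → G // D.IsColoring t S c} := by
      refine Nat.card_le_card_of_injective (fun c => ⟨ι ∘ c.1, fun x hx => ?_, fun x _ => ?_⟩) ?_
      · have := c.2 x
        have hx' : s x = some true := by simpa [S] using hx
        rwa [hx'] at this
      · have := c.2 x
        rcases hsx : s x with _ | _ | _ <;> rw [hsx] at this
        · exact this
        · exact Fits.conserved two (t := t.other) this
        · exact Fits.conserved two (t := t) this
      · intro c c' h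
        exact Subtype.ext (hι.comp_left (Subtype.mk.inj h))
    have hle : (Nat.card {c : D.E → C // ∀ x, t.Allows (s x) (D.colorsAt (ι ∘ c) x)} : ℝ) ≤
        n ^ (S.card + Nat.card (D.Circles t)) / n := by
      rw [le_div_iff₀ hn0, hn]
      exact_mod_cast (Nat.mul_le_mul_right _ hcard).trans (D.card_isColoring_le two hD S hS)
    have hprod : |∏ x, w (s x)| ≤ lam ^ (Fintype.card D.X - S.card) * μ ^ S.card := by
      rw [Finset.abs_prod, ← Finset.prod_compl_mul_prod S, ← Finset.card_compl]
      refine mul_le_mul ?_ ?_ (Finset.prod_nonneg fun _ _ => abs_nonneg _) (by positivity)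
      · rw [← Finset.prod_const]
        refine Finset.prod_le_prod (fun _ _ => abs_nonneg _) fun x hx => ?_
        have hx' : s x = some true := by simpa [S] using hx
        rw [hx', ← hlam, abs_of_pos hpos]
      · rw [← Finset.prod_const]
        refine Finset.prod_le_prod (fun _ _ => abs_nonneg _) fun x hx => ?_
        exact hμ _ (by simpa [S] using hx)
    have hSc : S.card ≤ Fintype.card D.X := Finset.card_le_univ S
    rw [abs_mul, Nat.abs_cast]
    calc _ ≤ (lam ^ (Fintype.card D.X - S.card) * μ ^ S.card) *
          (n ^ (S.card + Nat.card (D.Circles t)) / n) :=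
          mul_le_mul hprod hle (by positivity) (by positivity)
      _ = lam ^ (Fintype.card D.X - S.card) * (μ * n) ^ S.card *
          (n ^ Nat.card (D.Circles t) / n) := by rw [pow_add, mul_pow]; ring
      _ ≤ lam ^ (Fintype.card D.X - S.card) * (4 * lam) ^ S.card *
          (n ^ Nat.card (D.Circles t) / n) := by gcongr
      _ = 4 ^ S.card * lam ^ Fintype.card D.X * (n ^ Nat.card (D.Circles t) / n) := by
          rw [mul_pow, ← pow_sub_mul_pow lam hSc]; ring
      _ ≤ 4 ^ Fintype.card D.X * lam ^ Fintype.card D.X * (n ^ Nat.card (D.Circles t) / n) := by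
          gcongr
          norm_num
      _ = _ := by ring
  rw [M.partition_eq_sum_markers D t ι w hW, ← Finset.add_sum_erase _ _ (Finset.mem_univ s₀), hmain,
    add_sub_cancel_left]
  refine (Finset.abs_sum_le_sum_abs _ _).trans ((Finset.sum_le_card_nsmul _ _ _ fun s hs =>
    hterm s (Finset.ne_of_mem_erase hs)).trans ?_)
  have h3 : (Fintype.card (D.X → Option Bool) : ℝ) = 3 ^ Fintype.card D.X := by simp
  rw [nsmul_eq_mul, ← h3]
  gcongr
  exact Finset.card_le_univ _

end VertexModel


/-! ### Growth of the state sums of adequate diagrams -/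

section Growth

open Filter Topology

/-- The number `m` of colours may differ from the order `n` of the group, as it does for nonzero
colours; only `m / n → 1` matters. -/
theorem tendsto_div_one_of_abs_sub_le {Z lam m n : ℕ → ℝ} {c σ : ℕ} {B : ℝ}
    (h : ∀ k, |Z k - lam k ^ c * m k ^ σ| ≤ B * (lam k ^ c * n k ^ σ / n k))
    (hlam : ∀ k, 0 < lam k) (hn : ∀ k, 0 < n k) (hnt : Tendsto n atTop atTop)
    (hm : Tendsto (fun k => m k / n k) atTop (𝓝 1)) :
    Tendsto (fun k => Z k / (lam k ^ c * n k ^ σ)) atTop (𝓝 1) := by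
  have h1 : Tendsto (fun k => (m k / n k) ^ σ) atTop (𝓝 1) := by simpa using hm.pow σ
  have h2 : Tendsto (fun k => (Z k - lam k ^ c * m k ^ σ) / (lam k ^ c * n k ^ σ)) atTop (𝓝 0) := by
    refine squeeze_zero_norm (a := fun k => B / n k) (fun k => ?_) (hnt.const_div_atTop B)
    have hp : 0 < lam k ^ c * n k ^ σ := mul_pos (pow_pos (hlam k) _) (pow_pos (hn k) _)
    rw [Real.norm_eq_abs, abs_div, abs_of_pos hp, div_le_iff₀ hp]
    refine (h k).trans_eq ?_
    ring
  have h3 := h1.add h2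
  rw [add_zero] at h3
  refine h3.congr fun k => ?_
  have h4 := (hlam k).ne'
  have h5 := (hn k).ne'
  rw [div_pow]
  field_simp
  ring

/-- The model and its swap both carry `lam ^ c`, so their product contains `(lam ^ 2) ^ c`, which
grows like `n ^ (j * c)`. -/
theorem tendsto_abs_mul_div_one {Z Z' lam n : ℕ → ℝ} {c σ σ' j : ℕ} (hlam : ∀ k, 0 < lam k)
    (hn : ∀ k, 0 < n k) (hZ : Tendsto (fun k => Z k / (lam k ^ c * n k ^ σ)) atTop (𝓝 1))
    (hZ' : Tendsto (fun k => Z' k / (lam k ^ c * n k ^ σ')) atTop (𝓝 1))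
    (hj : Tendsto (fun k => lam k ^ 2 / n k ^ j) atTop (𝓝 1)) :
    Tendsto (fun k => |Z k * Z' k| / n k ^ (j * c + (σ + σ'))) atTop (𝓝 1) := by
  have h := ((hZ.mul hZ').mul (hj.pow c)).abs
  simp only [mul_one, one_pow, abs_one] at h
  refine h.congr fun k => ?_
  have hk : 0 < n k ^ (j * c + (σ + σ')) := pow_pos (hn k) _
  conv_rhs => rw [← abs_of_pos hk, ← abs_div]
  congr 1
  have h4 := (hlam k).ne'
  have h5 := (hn k).ne'
  rw [pow_add, pow_mul, pow_add, div_pow]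
  field_simp
  ring

theorem exponent_le_of_tendsto {P n : ℕ → ℝ} {d d' : ℕ} (hn : ∀ k, 0 < n k)
    (hnt : Tendsto n atTop atTop) (h : Tendsto (fun k => P k / n k ^ d) atTop (𝓝 1))
    (h' : Tendsto (fun k => P k / n k ^ d') atTop (𝓝 1)) : d ≤ d' := by
  by_contra! hlt
  obtain ⟨i, rfl⟩ := Nat.exists_eq_add_of_lt hlt
  have h0 : Tendsto (fun k => (n k ^ (i + 1))⁻¹) atTop (𝓝 0) :=
    ((tendsto_pow_atTop (Nat.succ_ne_zero i)).comp hnt).inv_tendsto_atTop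
  have h1 := h'.mul h0
  rw [one_mul] at h1
  -- A strictly larger exponent would make the first quotient the second one divided by a positive
  -- power of `n`, hence null.
  have h2 : (1 : ℝ) = 0 := tendsto_nhds_unique (h.congr fun k => ?_) h1
  · exact one_ne_zero h2
  · rw [add_assoc, pow_add]
    have h5 := (hn k).ne'
    field_simp

theorem exponent_eq_of_tendsto {P n : ℕ → ℝ} {d d' : ℕ} (hn : ∀ k, 0 < n k)
    (hnt : Tendsto n atTop atTop) (h : Tendsto (fun k => P k / n k ^ d) atTop (𝓝 1))
    (h' : Tendsto (fun k => P k / n k ^ d') atTop (𝓝 1)) : d = d' :=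
  le_antisymm (exponent_le_of_tendsto hn hnt h h') (exponent_le_of_tendsto hn hnt h' h)

/-- The larger solution `u` of `u + u⁻¹ = y`. -/
noncomputable def largerRoot (y : ℝ) : ℝ := (y + √(y ^ 2 - 4)) / 2

theorem one_le_largerRoot {y : ℝ} (hy : 2 ≤ y) : 1 ≤ largerRoot y := by
  have := Real.sqrt_nonneg (y ^ 2 - 4)
  unfold largerRoot
  linarith

theorem largerRoot_add_inv {y : ℝ} (hy : 2 ≤ y) : largerRoot y + (largerRoot y)⁻¹ = y := by
  have h0 : largerRoot y ≠ 0 := (zero_lt_one.trans_le (one_le_largerRoot hy)).ne'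
  have h1 : √(y ^ 2 - 4) ^ 2 = y ^ 2 - 4 := Real.sq_sqrt (by nlinarith)
  have h2 : largerRoot y ^ 2 + 1 = y * largerRoot y := by
    unfold largerRoot
    linear_combination h1 / 4
  field_simp
  linarith

/-- The inverse of the larger root lies between `0` and `1`, so the root itself lies between `n k -
b - 1` and `n k - b`. -/
theorem tendsto_largerRoot_div {n : ℕ → ℝ} {b : ℝ} (hnt : Tendsto n atTop atTop)
    (hy : ∀ k, 2 ≤ n k - b) : Tendsto (fun k => largerRoot (n k - b) / n k) atTop (𝓝 1) := by
  have h1 : Tendsto (fun k => (n k - b - 1) / n k) atTop (𝓝 1) := by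
    have := (hnt.const_div_atTop (b + 1)).const_sub 1
    rw [sub_zero] at this
    refine this.congr' ?_
    filter_upwards [hnt.eventually_gt_atTop 0] with k hk
    field_simp
    ring
  have h2 : Tendsto (fun k => (n k - b) / n k) atTop (𝓝 1) := by
    have := (hnt.const_div_atTop b).const_sub 1
    rw [sub_zero] at this
    refine this.congr' ?_
    filter_upwards [hnt.eventually_gt_atTop 0] with k hk
    field_simp
  have hb : ∀ k, n k - b - 1 ≤ largerRoot (n k - b) ∧ largerRoot (n k - b) ≤ n k - b := fun k => by
    have h3 := largerRoot_add_inv (hy k)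
    have h4 := one_le_largerRoot (hy k)
    have h5 : (largerRoot (n k - b))⁻¹ ≤ 1 := inv_le_one_of_one_le₀ h4
    have h6 : 0 < (largerRoot (n k - b))⁻¹ := inv_pos.mpr (by linarith)
    constructor <;> linarith
  refine tendsto_of_tendsto_of_tendsto_of_le_of_le' h1 h2 ?_ ?_
  · filter_upwards [hnt.eventually_gt_atTop 0] with k hk
    gcongr
    exact (hb k).1
  · filter_upwards [hnt.eventually_gt_atTop 0] with k hk
    gcongr
    exact (hb k).2

end Growth

/-! ### Asymptotics of the two sequences of models -/

section Sequences

open Filter Topology VertexSum Splice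

/-- The number of colours, `2 ^ (k + 2)`. -/
def colorCount (k : ℕ) : ℝ := 2 ^ (k + 2)

theorem four_le_colorCount (k : ℕ) : 4 ≤ colorCount k := by
  have : (1 : ℝ) ≤ 2 ^ k := one_le_pow₀ (by norm_num)
  unfold colorCount
  rw [pow_add]
  linarith

theorem colorCount_pos (k : ℕ) : 0 < colorCount k := by linarith [four_le_colorCount k]

theorem tendsto_colorCount : Tendsto colorCount atTop atTop :=
  (tendsto_pow_atTop_atTop_of_one_lt (by norm_num : (1 : ℝ) < 2)).comp (tendsto_add_atTop_nat 2)

theorem card_colors (k : ℕ) : (Fintype.card (Fin (k + 2) → ZMod 2) : ℝ) = colorCount k := by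
  simp [colorCount, ZMod.card]

theorem color_two (k : ℕ) : (2 : Fin (k + 2) → ZMod 2) = 0 := by
  funext i
  show (2 : ZMod 2) = 0
  decide

theorem color_add_self (k : ℕ) (g : Fin (k + 2) → ZMod 2) : g + g = 0 := by
  rw [← two_mul, color_two, zero_mul]

/-- The parameter of the Kauffman bracket with loop value `colorCount k`. -/
noncomputable def bracketParam (k : ℕ) : ℝ := √(largerRoot (colorCount k - 0))

/-- The parameter of the flow model with `colorCount k` colours. -/
noncomputable def flowParam (k : ℕ) : ℝ := largerRoot (colorCount k - 2)

theorem one_le_bracketParam (k : ℕ) : 1 ≤ bracketParam k :=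
  Real.one_le_sqrt.mpr (one_le_largerRoot (by linarith [four_le_colorCount k]))

theorem bracketParam_sq (k : ℕ) : bracketParam k ^ 2 = largerRoot (colorCount k - 0) :=
  Real.sq_sqrt (zero_le_one.trans (one_le_largerRoot (by linarith [four_le_colorCount k])))

theorem one_le_flowParam (k : ℕ) : 1 ≤ flowParam k :=
  one_le_largerRoot (by linarith [four_le_colorCount k])

theorem colorCount_eq_bracketParam (k : ℕ) :
    colorCount k = bracketParam k ^ 2 + (bracketParam k)⁻¹ ^ 2 := by
  rw [inv_pow, bracketParam_sq, largerRoot_add_inv (by linarith [four_le_colorCount k]), sub_zero]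

theorem colorCount_eq_flowParam (k : ℕ) :
    colorCount k = flowParam k + (flowParam k)⁻¹ + 2 := by
  rw [flowParam, largerRoot_add_inv (by linarith [four_le_colorCount k]), sub_add_cancel]

/-- A sequence of Kauffman brackets. -/
noncomputable def bracketSeq (k : ℕ) : VertexModel (Fin (k + 2) → ZMod 2) :=
  bracketModel _ (bracketParam k) (by linarith [one_le_bracketParam k])
    (by rw [card_colors, colorCount_eq_bracketParam])

/-- A sequence of flow models. -/
noncomputable def flowSeq (k : ℕ) : VertexModel {g : Fin (k + 2) → ZMod 2 // g ≠ 0} :=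
  flowModel _ (color_two k) (flowParam k) (by linarith [one_le_flowParam k])
    (by rw [card_colors, colorCount_eq_flowParam])

/-- The weights of the markers of a crossing in the Kauffman bracket. -/
noncomputable def bracketMarker (a : ℝ) : Option Bool → ℝ
  | none => 0
  | some true => a
  | some false => -a⁻¹

/-- The weights of the markers of a crossing in the flow model. -/
noncomputable def flowMarker (q : ℝ) : Option Bool → ℝ
  | none => -1
  | some true => q
  | some false => q⁻¹

open Classical in
theorem smoothingWeight_eq_sum {G : Type} [AddCommGroup G] [DecidableEq G] (a : ℝ) (t : Splice)
    (f : ZMod 4 → G) :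
    (match t with
      | .A => smoothingWeight a (-a⁻¹) (f 0) (f 1) (f 2) (f 3)
      | .B => smoothingWeight (-a⁻¹) a (f 0) (f 1) (f 2) (f 3)) =
    ∑ m, bracketMarker a m * if t.Allows m f then 1 else 0 := by
  cases t <;>
    simp only [Fintype.sum_option, Fintype.sum_bool, bracketMarker, Allows, other, fits_A, fits_B,
      smoothingWeight] <;>
    rcases Classical.propComplete (f 0 = f 1) with h1 | h1 <;>
    rcases Classical.propComplete (f 2 = f 3) with h2 | h2 <;>
    rcases Classical.propComplete (f 1 = f 2) with h3 | h3 <;>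
    rcases Classical.propComplete (f 3 = f 0) with h4 | h4 <;>
    simp only [h1, h2, h3, h4, if_true, if_false, and_true, and_false] <;> ring

-- For conserved colours either splice fits as soon as one joined pair agrees, so the single
-- equations in `flowWeight` are the full fitting conditions.
open Classical in
theorem flowWeight_eq_sum {G : Type} [CommRing G] [DecidableEq G] (two : (2 : G) = 0) (q : ℝ)
    (t : Splice) (f : ZMod 4 → G) :
    (match t with
      | .A => flowWeight q q⁻¹ (f 0) (f 1) (f 2) (f 3)
      | .B => flowWeight q⁻¹ q (f 0) (f 1) (f 2) (f 3)) =
    ∑ m, flowMarker q m * if t.Allows m f then 1 else 0 := by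
  have hA : (f 0 = f 1 ∧ f 2 = f 3) ↔ f 0 + f 1 + f 2 + f 3 = 0 ∧ f 0 = f 1 := by grind
  have hB : (f 1 = f 2 ∧ f 3 = f 0) ↔ f 0 + f 1 + f 2 + f 3 = 0 ∧ f 1 = f 2 := by grind
  cases t <;>
    simp only [Fintype.sum_option, Fintype.sum_bool, flowMarker, Allows, other, fits_A, fits_B,
      hA, hB, flowWeight, Conserved] <;>
    rcases Classical.propComplete (f 0 + f 1 + f 2 + f 3 = 0) with h | h <;>
    rcases Classical.propComplete (f 0 = f 1) with h1 | h1 <;>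
    rcases Classical.propComplete (f 1 = f 2) with h2 | h2 <;>
    simp only [h, h1, h2, if_true, if_false, and_true, and_false] <;>
    ring

theorem weightFrom_bracketSeq (k : ℕ) (f : ZMod 4 → Fin (k + 2) → ZMod 2) :
    weightFrom (bracketSeq k).W f 0 =
        smoothingWeight (bracketParam k) (-(bracketParam k)⁻¹) (f 0) (f 1) (f 2) (f 3) ∧
      weightFrom (bracketSeq k).swap.W f 0 =
        smoothingWeight (-(bracketParam k)⁻¹) (bracketParam k) (f 0) (f 1) (f 2) (f 3) := by
  constructor <;> rfl

theorem weightFrom_flowSeq (k : ℕ) (f : ZMod 4 → {g : Fin (k + 2) → ZMod 2 // g ≠ 0}) :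
    weightFrom (flowSeq k).W f 0 =
        flowWeight (flowParam k) (flowParam k)⁻¹ (f 0 : Fin (k + 2) → ZMod 2) (f 1) (f 2) (f 3) ∧
      weightFrom (flowSeq k).swap.W f 0 =
        flowWeight (flowParam k)⁻¹ (flowParam k) (f 0 : Fin (k + 2) → ZMod 2) (f 1) (f 2) (f 3) := by
  constructor <;> rfl

theorem tendsto_bracketSeq (D : DiagramCode) (hA : D.SeparatesAt .A) (hB : D.SeparatesAt .B) :
    Tendsto (fun k => |(bracketSeq k).partition D * (bracketSeq k).swap.partition D| /
      colorCount k ^ (1 * Nat.card D.X + (Nat.card (D.Circles .A) + Nat.card (D.Circles .B))))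
      atTop (𝓝 1) := by
  have := D.finX
  let _ := Fintype.ofFinite D.X
  have hp : ∀ k, 0 < bracketParam k := fun k => by linarith [one_le_bracketParam k]
  have hμ : ∀ k, ∀ m ≠ some true, |bracketMarker (bracketParam k) m| ≤ (bracketParam k)⁻¹ := by
    intro k m hm
    rcases m with _ | _ | _
    · simpa [bracketMarker] using (hp k).le
    · simp [bracketMarker, abs_of_pos (hp k)]
    · exact absurd rfl hm
  -- With `a` the parameter, the left side is `a + a⁻¹ ^ 3`, at most `2 * a`.
  have hμw : ∀ k, (bracketParam k)⁻¹ * Fintype.card (Fin (k + 2) → ZMod 2) ≤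
      4 * bracketMarker (bracketParam k) (some true) := fun k => by
    rw [card_colors, colorCount_eq_bracketParam]
    have h1 := one_le_bracketParam k
    have h2 : (bracketParam k)⁻¹ ≤ 1 := inv_le_one_of_one_le₀ h1
    have h3 : 0 < (bracketParam k)⁻¹ := inv_pos.mpr (hp k)
    have h4 : (bracketParam k)⁻¹ * bracketParam k ^ 2 = bracketParam k := by
      rw [pow_two, ← mul_assoc, inv_mul_cancel₀ (hp k).ne', one_mul]
    have h5 : (bracketParam k)⁻¹ * (bracketParam k)⁻¹ ^ 2 ≤ 1 :=
      mul_le_one₀ h2 (by positivity) (pow_le_one₀ h3.le h2)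
    rw [mul_add, h4]
    show _ ≤ 4 * bracketParam k
    linarith
  have hone : Tendsto (fun k => colorCount k / colorCount k) atTop (𝓝 1) :=
    tendsto_const_nhds.congr fun k => (div_self (colorCount_pos k).ne').symm
  refine tendsto_abs_mul_div_one (lam := bracketParam) hp colorCount_pos
    (tendsto_div_one_of_abs_sub_le (B := 3 ^ Nat.card D.X * 4 ^ Nat.card D.X) (m := colorCount)
      (fun k => ?_) hp colorCount_pos tendsto_colorCount hone)
    (tendsto_div_one_of_abs_sub_le (B := 3 ^ Nat.card D.X * 4 ^ Nat.card D.X) (m := colorCount)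
      (fun k => ?_) hp colorCount_pos tendsto_colorCount hone) ?_
  · have h := (bracketSeq k).abs_partition_sub_le D hA (color_add_self k) (ι := id)
      Function.injective_id _ (fun f => (weightFrom_bracketSeq k f).1.trans
        (smoothingWeight_eq_sum _ .A f)) (hp k) (hμ k) (hμw k)
    rw [card_colors, ← Nat.card_eq_fintype_card] at h
    refine h.trans_eq ?_
    simp only [bracketMarker]
    ring
  · have h := (bracketSeq k).swap.abs_partition_sub_le D hB (color_add_self k) (ι := id)
      Function.injective_id _ (fun f => (weightFrom_bracketSeq k f).2.trans
        (smoothingWeight_eq_sum _ .B f)) (hp k) (hμ k) (hμw k)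
    rw [card_colors, ← Nat.card_eq_fintype_card] at h
    refine h.trans_eq ?_
    simp only [bracketMarker]
    ring
  -- The square of the splice weight is the larger root, hence grows like the first power of the
  -- loop value.
  · simp only [bracketParam_sq, pow_one]
    exact tendsto_largerRoot_div tendsto_colorCount fun k => by linarith [four_le_colorCount k]

theorem card_nonzero_colors (k : ℕ) :
    (Fintype.card {g : Fin (k + 2) → ZMod 2 // g ≠ 0} : ℝ) = colorCount k - 1 := by
  rw [Fintype.card_subtype_compl, Fintype.card_subtype_eq, Nat.cast_sub Fintype.card_pos,
    card_colors, Nat.cast_one]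

theorem tendsto_flowSeq (D : DiagramCode) (hA : D.SeparatesAt .A) (hB : D.SeparatesAt .B) :
    Tendsto (fun k => |(flowSeq k).partition D * (flowSeq k).swap.partition D| /
      colorCount k ^ (2 * Nat.card D.X + (Nat.card (D.Circles .A) + Nat.card (D.Circles .B))))
      atTop (𝓝 1) := by
  have := D.finX
  let _ := Fintype.ofFinite D.X
  have hp : ∀ k, 0 < flowParam k := fun k => by linarith [one_le_flowParam k]
  have hinv : ∀ k, (flowParam k)⁻¹ ≤ 1 := fun k => inv_le_one_of_one_le₀ (one_le_flowParam k)
  have hμ : ∀ k, ∀ m ≠ some true, |flowMarker (flowParam k) m| ≤ 1 := by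
    intro k m hm
    rcases m with _ | _ | _
    · simp [flowMarker]
    · rw [flowMarker, abs_of_pos (inv_pos.mpr (hp k))]
      exact hinv k
    · exact absurd rfl hm
  have hμw : ∀ k, 1 * (Fintype.card (Fin (k + 2) → ZMod 2) : ℝ) ≤
      4 * flowMarker (flowParam k) (some true) := fun k => by
    rw [card_colors, colorCount_eq_flowParam]
    show _ ≤ 4 * flowParam k
    linarith [one_le_flowParam k, hinv k]
  -- The zero colour is forbidden on arcs, so there is one colour fewer than group elements.
  have hone : Tendsto (fun k => (colorCount k - 1) / colorCount k) atTop (𝓝 1) := by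
    have := (tendsto_colorCount.const_div_atTop 1).const_sub 1
    rw [sub_zero] at this
    refine this.congr fun k => ?_
    have := (colorCount_pos k).ne'
    field_simp
  refine tendsto_abs_mul_div_one (lam := flowParam) hp colorCount_pos
    (tendsto_div_one_of_abs_sub_le (B := 3 ^ Nat.card D.X * 4 ^ Nat.card D.X)
      (m := fun k => colorCount k - 1)
      (fun k => ?_) hp colorCount_pos tendsto_colorCount hone)
    (tendsto_div_one_of_abs_sub_le (B := 3 ^ Nat.card D.X * 4 ^ Nat.card D.X)
      (m := fun k => colorCount k - 1)
      (fun k => ?_) hp colorCount_pos tendsto_colorCount hone) ?_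
  · have h := (flowSeq k).abs_partition_sub_le D hA (color_add_self k) (ι := Subtype.val)
      Subtype.val_injective _ (fun f => (weightFrom_flowSeq k f).1.trans
        (flowWeight_eq_sum (color_two k) _ .A fun i => (f i : Fin (k + 2) → ZMod 2)))
      (hp k) (hμ k) (hμw k)
    rw [card_colors, card_nonzero_colors, ← Nat.card_eq_fintype_card] at h
    refine h.trans_eq ?_
    simp only [flowMarker]
    ring
  · have h := (flowSeq k).swap.abs_partition_sub_le D hB (color_add_self k) (ι := Subtype.val)
      Subtype.val_injective _ (fun f => (weightFrom_flowSeq k f).2.trans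
        (flowWeight_eq_sum (color_two k) _ .B fun i => (f i : Fin (k + 2) → ZMod 2)))
      (hp k) (hμ k) (hμw k)
    rw [card_colors, card_nonzero_colors, ← Nat.card_eq_fintype_card] at h
    refine h.trans_eq ?_
    simp only [flowMarker]
    ring
  · have h := (tendsto_largerRoot_div (b := 2) tendsto_colorCount
      fun k => by linarith [four_le_colorCount k]).pow 2
    rw [one_pow] at h
    refine h.congr fun k => ?_
    rw [div_pow]
    rfl

/-- The number of crossings and the total number of state circles of the two extreme states agree
for adequate diagrams of the same link. -/
theorem card_eq_of_link_eq {D D' : LinkDiagram} (h : D.link = D'.link) (hA : D.SeparatesAt .A)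
    (hB : D.SeparatesAt .B) (hA' : D'.SeparatesAt .A) (hB' : D'.SeparatesAt .B) :
    Nat.card D.X = Nat.card D'.X ∧
      Nat.card (D.Circles .A) + Nat.card (D.Circles .B) =
        Nat.card (D'.Circles .A) + Nat.card (D'.Circles .B) := by
  have h1 := tendsto_bracketSeq D.toDiagramCode hA hB
  have h2 := tendsto_flowSeq D.toDiagramCode hA hB
  have e1 : ∀ k, |(bracketSeq k).partition D.toDiagramCode *
      (bracketSeq k).swap.partition D.toDiagramCode| = _ := fun k =>
    (bracketSeq k).abs_partition_mul_eq_of_link_eq (by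
      have : bracketParam k ≠ 0 := by linarith [one_le_bracketParam k]
      show |bracketParam k ^ 3 * -(bracketParam k)⁻¹ ^ 3| = 1
      rw [mul_neg, ← mul_pow, mul_inv_cancel₀ this, one_pow, abs_neg, abs_one])
      (by show |(-1 : ℝ)| = 1; simp) h
  have e2 : ∀ k, |(flowSeq k).partition D.toDiagramCode *
      (flowSeq k).swap.partition D.toDiagramCode| = _ := fun k =>
    have : Nonempty {g : Fin (k + 2) → ZMod 2 // g ≠ 0} := ⟨⟨1, one_ne_zero⟩⟩
    (flowSeq k).abs_partition_mul_eq_of_link_eq (by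
      have : flowParam k ≠ 0 := by linarith [one_le_flowParam k]
      show |flowParam k ^ 2 * (flowParam k)⁻¹ ^ 2| = 1
      rw [← mul_pow, mul_inv_cancel₀ this, one_pow, abs_one])
      (by show |(1 : ℝ)| = 1; simp) h
  simp only [e1] at h1
  simp only [e2] at h2
  have h3 := exponent_eq_of_tendsto colorCount_pos tendsto_colorCount h1
    (tendsto_bracketSeq D'.toDiagramCode hA' hB')
  -- The exponents contain the number of crossings once for the bracket and twice for flows, so
  -- their difference isolates it.
  have h4 := exponent_eq_of_tendsto colorCount_pos tendsto_colorCount h2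
    (tendsto_flowSeq D'.toDiagramCode hA' hB')
  omega

end Sequences


/-! ### The genus of the ribbon graphs of a diagram -/

section Cycles

variable {β γ : Type}

theorem Equiv.Perm.SameCycle.map_eq {σ : Equiv.Perm β} {f : β → γ} (hf : ∀ b, f (σ b) = f b) {a b : β}
    (h : σ.SameCycle a b) : f a = f b := by
  obtain ⟨n, rfl⟩ := h
  induction n using Int.induction_on with
  | zero => simp
  | succ n ih => rw [add_comm, zpow_add, zpow_one, Equiv.Perm.mul_apply, hf, ih]
  | pred n ih =>
    rw [ih, ← hf ((σ ^ (-(n : ℤ) - 1)) a), ← Equiv.Perm.mul_apply, ← zpow_one_add]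
    congr 3
    ring

theorem numCycles_inv (σ : Equiv.Perm β) : numCycles σ⁻¹ = numCycles σ :=
  Nat.card_congr (Quotient.congr (Equiv.refl β) fun _ _ => Equiv.Perm.sameCycle_inv)

/-- The two products are conjugate by `τ`. -/
theorem numCycles_mul_comm (σ τ : Equiv.Perm β) : numCycles (σ * τ) = numCycles (τ * σ) := by
  refine Nat.card_congr (Quotient.congr τ fun a b => ?_)
  show (σ * τ).SameCycle a b ↔ (τ * σ).SameCycle (τ a) (τ b)
  rw [show τ * σ = τ * (σ * τ) * τ⁻¹ by group, Equiv.Perm.sameCycle_conj]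
  simp

end Cycles

theorem Splice.partner_other (t : Splice) (i : ZMod 4) : t.other.partner i = t.partner i + 2 := by
  cases t <;> revert i <;> decide

theorem Splice.partner_two (t : Splice) : t.partner 2 = t.partner 0 + 2 := by
  cases t <;> decide

namespace DiagramCode

variable {D : DiagramCode} (o : D.CircleOrientation)

namespace CircleOrientation

theorem exists_out_label_eq (h : D.X × ZMod 4) :
    ∃ b : {h : D.X × ZMod 4 // o.out h = true}, D.label b.1 = D.label h := by
  cases ho : o.out h
  · exact ⟨⟨D.otherEnd h, by rw [o.out_otherEnd, ho]; rfl⟩, D.label_otherEnd h⟩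
  · exact ⟨⟨h, ho⟩, rfl⟩

theorem eq_of_label_eq {b b' : {h : D.X × ZMod 4 // o.out h = true}}
    (h : D.label b.1 = D.label b'.1) : b = b' := by
  by_contra hne
  have h1 : b.1 = D.otherEnd b'.1 := (D.existsUnique_otherEnd b'.1).unique
    ⟨fun e => hne (Subtype.ext e), h⟩ ⟨D.otherEnd_ne _, D.label_otherEnd _⟩
  have h2 := o.out_otherEnd b'.1
  rw [← h1, b.2, b'.2] at h2
  exact absurd h2 (by decide)

theorem exists_out (x : D.X) : ∃ b : {h : D.X × ZMod 4 // o.out h = true}, b.1.1 = x := by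
  cases ho : o.out (x, 0)
  · exact ⟨⟨(x, 0 + 1), by rw [o.out_next, ho]; rfl⟩, rfl⟩
  · exact ⟨⟨(x, 0), ho⟩, rfl⟩

theorem eq_or_eq_crossPerm {b b' : {h : D.X × ZMod 4 // o.out h = true}} (h : b'.1.1 = b.1.1) :
    b' = b ∨ b' = D.crossPerm o b := by
  obtain ⟨⟨x, i⟩, hi⟩ := b
  obtain ⟨⟨y, j⟩, hj⟩ := b'
  obtain rfl : y = x := h
  have hij : ∀ i j : ZMod 4, j = i ∨ j = i + 2 ∨ j = i + 1 ∨ i = j + 1 := by decide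
  rcases hij i j with rfl | rfl | rfl | rfl
  · exact Or.inl rfl
  · exact Or.inr rfl
  · rw [o.out_next, hi] at hj
    exact absurd hj (by decide)
  · rw [o.out_next, hj] at hi
    exact absurd hi (by decide)

theorem circlePerm_eq {t : Splice} {x : D.X} {i : ZMod 4}
    {b b' : {h : D.X × ZMod 4 // o.out h = true}} (hb : D.label b.1 = D.label (x, i))
    (hi : o.out (x, i) = false) (hb' : b'.1 = (x, t.partner i)) :
    D.circlePerm o (fun _ => t) b = b' := by
  have h1 : (x, i) = D.otherEnd b.1 := (D.existsUnique_otherEnd b.1).unique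
    ⟨fun e => by rw [e, b.2] at hi; exact absurd hi (by decide), hb.symm⟩
    ⟨D.otherEnd_ne _, D.label_otherEnd _⟩
  apply Subtype.ext
  show ((D.otherEnd b.1).1, t.partner (D.otherEnd b.1).2) = b'.1
  rw [← h1, hb']

theorem sameCycle_of_spliceRel {t : Splice} {b b' : {h : D.X × ZMod 4 // o.out h = true}}
    (h : D.SpliceRel t (D.label b.1) (D.label b'.1)) :
    (D.circlePerm o fun _ => t).SameCycle b b' := by
  obtain ⟨x, i, h1, h2⟩ := h
  have hout : o.out (x, t.partner i) = !o.out (x, i) := o.out_partner (fun _ => t) (x, i)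
  cases hi : o.out (x, i)
  · rw [hi] at hout
    have e : (⟨_, hout⟩ : {h // o.out h = true}) = b' := o.eq_of_label_eq h2
    have := o.circlePerm_eq h1.symm hi (congrArg Subtype.val e).symm
    exact ⟨1, by simpa using this⟩
  · rw [hi] at hout
    have e : (⟨_, hi⟩ : {h // o.out h = true}) = b := o.eq_of_label_eq h1
    have := o.circlePerm_eq (t := t) (b' := b) h2.symm hout
      (by rw [t.partner_partner, ← congrArg Subtype.val e])
    exact Equiv.Perm.SameCycle.symm ⟨1, by simpa using this⟩

open Classical in
/-- The vertex that an arc belongs to. -/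
noncomputable def vertexOf (t : Splice) (a : D.E) :
    Quotient (Equiv.Perm.SameCycle.setoid (D.circlePerm o fun _ => t)) ⊕
      {a : D.E | ∀ h, D.label h ≠ a} :=
  if h : ∃ b : {h : D.X × ZMod 4 // o.out h = true}, D.label b.1 = a then
    Sum.inl (Quotient.mk _ h.choose)
  else Sum.inr ⟨a, fun h' e => h (by rw [← e]; exact o.exists_out_label_eq h')⟩

theorem vertexOf_label (t : Splice) (b : {h : D.X × ZMod 4 // o.out h = true}) :
    o.vertexOf t (D.label b.1) = Sum.inl (Quotient.mk _ b) := by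
  have h : ∃ b' : {h : D.X × ZMod 4 // o.out h = true}, D.label b'.1 = D.label b.1 := ⟨b, rfl⟩
  rw [vertexOf, dif_pos h, o.eq_of_label_eq h.choose_spec]

theorem vertexOf_isolated (t : Splice) (a : {a : D.E | ∀ h, D.label h ≠ a}) :
    o.vertexOf t a.1 = Sum.inr a :=
  dif_neg fun ⟨b, hb⟩ => a.2 b.1 hb

theorem vertexOf_eq_of_spliceRel {t : Splice} {a a' : D.E} (h : D.SpliceRel t a a') :
    o.vertexOf t a = o.vertexOf t a' := by
  have h' := h
  obtain ⟨x, i, rfl, rfl⟩ := h'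
  obtain ⟨b, hb⟩ := o.exists_out_label_eq (x, i)
  obtain ⟨b', hb'⟩ := o.exists_out_label_eq (x, t.partner i)
  rw [← hb, ← hb'] at h ⊢
  rw [vertexOf_label, vertexOf_label]
  exact congrArg _ (Quotient.sound (o.sameCycle_of_spliceRel h))

/-- The state circles are the vertices of the ribbon graph. -/
noncomputable def circlesEquiv (t : Splice) :
    D.Circles t ≃ Quotient (Equiv.Perm.SameCycle.setoid (D.circlePerm o fun _ => t)) ⊕
      {a : D.E | ∀ h, D.label h ≠ a} where
  toFun := Quot.lift (o.vertexOf t) fun _ _ h => o.vertexOf_eq_of_spliceRel h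
  invFun := Sum.elim
    (Quotient.lift (fun b => (Quot.mk _ (D.label b.1) : D.Circles t)) fun b b' h =>
      Equiv.Perm.SameCycle.map_eq
        (f := fun b : {h : D.X × ZMod 4 // o.out h = true} =>
          (Quot.mk _ (D.label b.1) : D.Circles t))
        (fun b => (Quot.sound ⟨(D.otherEnd b.1).1, (D.otherEnd b.1).2,
          D.label_otherEnd b.1, rfl⟩).symm) h)
    fun a => Quot.mk _ a.1
  left_inv := by
    rintro ⟨a⟩
    by_cases h : ∃ h, D.label h = a
    · obtain ⟨h, rfl⟩ := h
      obtain ⟨b, hb⟩ := o.exists_out_label_eq h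
      show Sum.elim _ _ (o.vertexOf t (D.label h)) = _
      rw [← hb, vertexOf_label]
      rfl
    · show Sum.elim _ _ (o.vertexOf t a) = _
      rw [o.vertexOf_isolated t ⟨a, fun h' e => h ⟨h', e⟩⟩]
      rfl
  right_inv := by
    rintro (b | a)
    · induction b using Quotient.inductionOn with
      | h b => exact o.vertexOf_label t b
    · exact o.vertexOf_isolated t a

theorem sameCycle_of_mk_eq {t : Splice} {b b' : {h : D.X × ZMod 4 // o.out h = true}}
    (h : (Quot.mk _ (D.label b.1) : D.Circles t) = Quot.mk _ (D.label b'.1)) :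
    (D.circlePerm o fun _ => t).SameCycle b b' := by
  have h1 : o.vertexOf t (D.label b.1) = o.vertexOf t (D.label b'.1) :=
    congrArg (o.circlesEquiv t) h
  rw [vertexOf_label, vertexOf_label] at h1
  exact Quotient.exact (Sum.inl_injective h1)

theorem finite_out : Finite {h : D.X × ZMod 4 // o.out h = true} :=
  (D.stateRibbonGraph o fun _ => .A).finB

theorem v_stateRibbonGraph (t : Splice) :
    (D.stateRibbonGraph o fun _ => t).v = Nat.card (D.Circles t) := by
  have := D.finE
  have := o.finite_out
  rw [Nat.card_congr (o.circlesEquiv t), Nat.card_sum, Nat.card_coe_set_eq]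
  rfl

/-- The partner under one splice is opposite to the partner under the other. -/
theorem crossPerm_mul_circlePerm (t : Splice) :
    D.crossPerm o * D.circlePerm o (fun _ => t) = D.circlePerm o fun _ => t.other := by
  ext1 b
  apply Subtype.ext
  show ((D.otherEnd b.1).1, t.partner (D.otherEnd b.1).2 + 2) =
    ((D.otherEnd b.1).1, t.other.partner (D.otherEnd b.1).2)
  rw [t.partner_other]

/-- Up to inversion and conjugation `σ₂` is the vertex permutation of the other state. This duality
is why the two extreme states have equal genus. -/
theorem f_stateRibbonGraph (t : Splice) :
    (D.stateRibbonGraph o fun _ => t).f = Nat.card (D.Circles t.other) := by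
  rw [← o.v_stateRibbonGraph]
  show numCycles (D.circlePerm o (fun _ => t) * D.crossPerm o)⁻¹ + _ =
    numCycles (D.circlePerm o fun _ => t.other) + _
  rw [numCycles_inv, numCycles_mul_comm, crossPerm_mul_circlePerm]
  rfl

theorem e_stateRibbonGraph (t : Splice) :
    (D.stateRibbonGraph o fun _ => t).e = Nat.card D.X := by
  refine Nat.card_eq_of_bijective (Quotient.lift (fun b => b.1.1) fun b b' h =>
    Equiv.Perm.SameCycle.map_eq (σ := D.crossPerm o) (f := fun b => b.1.1) (fun _ => rfl) h) ⟨?_, fun x => ?_⟩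
  · rintro ⟨b⟩ ⟨b'⟩ h
    have h : b.1.1 = b'.1.1 := h
    refine Quotient.sound (?_ : (D.crossPerm o).SameCycle b b')
    rcases o.eq_or_eq_crossPerm h.symm with rfl | rfl
    · exact Equiv.Perm.SameCycle.refl _ _
    · exact ⟨1, by simp⟩
  · obtain ⟨b, hb⟩ := o.exists_out x
    exact ⟨Quotient.mk _ b, hb⟩

/-- The group generated by `σ₀` and `σ₁`. -/
abbrev cartographicGroup (t : Splice) : Subgroup (Equiv.Perm {h : D.X × ZMod 4 // o.out h = true}) :=
  Subgroup.closure {D.circlePerm o (fun _ => t), D.crossPerm o}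

theorem orbitRel_circlePerm (t : Splice) (b : {h : D.X × ZMod 4 // o.out h = true}) :
    MulAction.orbitRel (o.cartographicGroup t) _ (D.circlePerm o (fun _ => t) b) b :=
  ⟨⟨D.circlePerm o fun _ => t, Subgroup.subset_closure (Or.inl rfl)⟩, rfl⟩

theorem orbitRel_crossPerm (t : Splice) (b : {h : D.X × ZMod 4 // o.out h = true}) :
    MulAction.orbitRel (o.cartographicGroup t) _ (D.crossPerm o b) b :=
  ⟨⟨D.crossPerm o, Subgroup.subset_closure (Or.inr rfl)⟩, rfl⟩

theorem orbitRel_of_crossing_eq (t : Splice) {b b' : {h : D.X × ZMod 4 // o.out h = true}}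
    (h : b'.1.1 = b.1.1) : MulAction.orbitRel (o.cartographicGroup t) _ b' b := by
  rcases o.eq_or_eq_crossPerm h with rfl | rfl
  · exact Setoid.refl' _ _
  · exact o.orbitRel_crossPerm t b

theorem orbitRel_of_label_eq (t : Splice) {b b' : {h : D.X × ZMod 4 // o.out h = true}}
    {i : ZMod 4} (h : D.label b.1 = D.label (b'.1.1, i)) :
    MulAction.orbitRel (o.cartographicGroup t) _ b b' := by
  have hout : o.out (b'.1.1, t.partner i) = !o.out (b'.1.1, i) :=
    o.out_partner (fun _ => t) (b'.1.1, i)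
  cases hi : o.out (b'.1.1, i)
  · rw [hi] at hout
    refine Setoid.trans' _ (Setoid.symm' _ (o.orbitRel_circlePerm t b)) ?_
    rw [o.circlePerm_eq (b' := ⟨_, hout⟩) h hi rfl]
    exact o.orbitRel_of_crossing_eq t rfl
  · rw [o.eq_of_label_eq (b := b) (b' := ⟨_, hi⟩) h]
    exact o.orbitRel_of_crossing_eq t rfl

theorem orbitRel_of_eqvGen_touch (t : Splice) (hE : ∀ a, ∃ h, D.label h = a) {a a' : D.E}
    (h : Relation.EqvGen D.Touch a a') (b b' : {h : D.X × ZMod 4 // o.out h = true})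
    (hb : D.label b.1 = a) (hb' : D.label b'.1 = a') :
    MulAction.orbitRel (o.cartographicGroup t) _ b b' := by
  induction h generalizing b b' with
  | rel a a' h =>
    obtain ⟨x, i, j, rfl, rfl⟩ := h
    obtain ⟨b₀, rfl⟩ := o.exists_out x
    exact Setoid.trans' _ (o.orbitRel_of_label_eq t hb) (Setoid.symm' _ (o.orbitRel_of_label_eq t hb'))
  | refl a =>
    rw [o.eq_of_label_eq (hb.trans hb'.symm)]
  | symm a a' _ ih => exact Setoid.symm' _ (ih _ _ hb' hb)
  | trans a a' a'' _ _ ih ih' =>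
    obtain ⟨h, rfl⟩ := hE a'
    obtain ⟨c, hc⟩ := o.exists_out_label_eq h
    exact Setoid.trans' _ (ih b c hb hc) (ih' c b' hc hb')

theorem k_stateRibbonGraph (t : Splice) (hD : D.IsConnected) :
    (D.stateRibbonGraph o fun _ => t).k = 1 := by
  show Nat.card (MulAction.orbitRel.Quotient (o.cartographicGroup t)
    {h : D.X × ZMod 4 // o.out h = true}) +
    {a | ∀ h, D.label h ≠ a}.ncard = 1
  obtain ⟨⟨a⟩, hcon⟩ := hD
  by_cases hE : ∀ a, ∃ h, D.label h = a
  · have h0 : {a | ∀ h, D.label h ≠ a} = ∅ :=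
      Set.eq_empty_of_forall_notMem fun a ha => (hE a).elim ha
    rw [h0, Set.ncard_empty, add_zero, Nat.card_eq_one_iff_unique]
    refine ⟨⟨?_⟩, ?_⟩
    · rintro ⟨b⟩ ⟨b'⟩
      exact Quotient.sound (o.orbitRel_of_eqvGen_touch t hE (hcon _ _) b b' rfl rfl)
    · obtain ⟨h, -⟩ := hE a
      obtain ⟨b, -⟩ := o.exists_out h.1
      exact ⟨Quotient.mk _ b⟩
  -- A closed curve without crossings touches nothing else, so it is the whole diagram: no
  -- half-edges and one isolated component.
  · push Not at hE
    obtain ⟨a, ha⟩ := hE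
    have hall : ∀ b, b = a := by
      have key : ∀ u w, Relation.EqvGen D.Touch u w → (u = a ↔ w = a) := fun u w h => by
        induction h with
        | rel u w h =>
          obtain ⟨x, i, j, rfl, rfl⟩ := h
          exact iff_of_false (ha _) (ha _)
        | refl => rfl
        | symm _ _ _ ih => exact ih.symm
        | trans _ _ _ _ _ ih ih' => exact ih.trans ih'
      exact fun b => (key a b (hcon a b)).mp rfl
    have h1 : {a | ∀ h, D.label h ≠ a} = {a} :=
      Set.ext fun b => ⟨fun _ => hall b, fun hb => by rw [hall b]; exact ha⟩
    have : IsEmpty (MulAction.orbitRel.Quotient (o.cartographicGroup t)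
        {h : D.X × ZMod 4 // o.out h = true}) :=
      ⟨by rintro ⟨b⟩; exact ha b.1 (hall _)⟩
    rw [h1, Set.ncard_singleton, Nat.card_of_isEmpty]

theorem genus_stateRibbonGraph (t : Splice) (hD : D.IsConnected) :
    (D.stateRibbonGraph o fun _ => t).genus =
      (2 - ((Nat.card (D.Circles .A) + Nat.card (D.Circles .B) : ℕ) : ℚ) + Nat.card D.X) / 2 := by
  rw [RibbonGraph.genus, o.k_stateRibbonGraph t hD, v_stateRibbonGraph, e_stateRibbonGraph,
    f_stateRibbonGraph]
  cases t <;> simp only [Splice.other] <;> push_cast <;> ring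

theorem separatesAt_of_loopless {t : Splice} (h : (D.stateRibbonGraph o fun _ => t).Loopless) :
    D.SeparatesAt t := by
  intro x hx
  have hout : o.out (x, t.partner 0) = !o.out (x, 0) := o.out_partner (fun _ => t) (x, 0)
  -- The half-edge is the outgoing one of the ends `0` and `t.partner 0`, which lie on the same
  -- piece of state circle.
  cases hi : o.out (x, 0)
  · rw [hi] at hout
    refine h ⟨_, hout⟩ (o.sameCycle_of_mk_eq ?_)
    show Quot.mk _ _ = Quot.mk _ (D.label (x, t.partner 0 + 2))
    rw [← t.partner_two]
    exact ((Quot.sound ⟨x, 0, rfl, rfl⟩).symm.trans hx).trans (Quot.sound ⟨x, 2, rfl, rfl⟩)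
  · exact h ⟨_, hi⟩ (o.sameCycle_of_mk_eq hx)

end CircleOrientation

end DiagramCode


/-! ### Invariance of the genus -/

theorem mainTheorem4 (L : Link) :
    ∃ g : ℚ, ∀ P : LinkDiagram, P.link = L → P.IsConnected → P.IsAdequate →
      ∀ o : P.CircleOrientation, (P.ribbonA o).genus = g ∧ (P.ribbonB o).genus = g := by
  have key : ∀ P P' : LinkDiagram, P.link = P'.link → P.IsAdequate → P'.IsConnected →
      P'.IsAdequate → ∀ (t : Splice) (o : P'.CircleOrientation),
      (P'.stateRibbonGraph o fun _ => t).genus =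
        (2 - ((Nat.card (P.Circles .A) + Nat.card (P.Circles .B) : ℕ) : ℚ) + Nat.card P.X) / 2 := by
    intro P P' h hP hc' hP' t o'
    -- Adequacy quantifies over orientations, so one must exist before it yields separation;
    -- planarity supplies it.
    obtain ⟨o⟩ := P.nonempty_circleOrientation P.planar
    obtain ⟨h1, h2⟩ := card_eq_of_link_eq h (o.separatesAt_of_loopless (hP o).1)
      (o.separatesAt_of_loopless (hP o).2) (o'.separatesAt_of_loopless (hP' o').1)
      (o'.separatesAt_of_loopless (hP' o').2)
    rw [o'.genus_stateRibbonGraph t hc', h1, h2]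
  by_cases hL : ∃ P : LinkDiagram, P.link = L ∧ P.IsAdequate
  · obtain ⟨P, rfl, hP⟩ := hL
    -- The common value is computed from one adequate diagram of the link.
    exact ⟨_, fun P' h hc hP' o => ⟨key P P' h.symm hP hc hP' .A o, key P P' h.symm hP hc hP' .B o⟩⟩
  -- Without adequate diagrams any value serves.
  · exact ⟨0, fun P h _ hP => absurd ⟨P, h, hP⟩ hL⟩
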